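/- Let $X\subseteq\mathbb R^d$ be closed and convex and consider $$\min_{x\in X} f(x)=\mathbb E[\tilde f(x,\xi)]\quad\text{subject to}\quad c(x)=\mathbb E[\tilde c(x,\zeta)]=0\in\mathbb R^m ,$$ with $f,c_1,\dots,c_m$ differentiable at the points of $X$. For $x\in X$ let $N_X(x)=\{v:\langle v,y-x\rangle\le 0\ \forall y\in X\}$ and $\mathsf d(v,S)=\inf_{w\in S}\|v-w\|$ (Euclidean norms), let $P_X$ be the projection onto $X$, let $\nabla c(x)^\top\lambda=\sum_i\lambda_i\nabla c_i(x)$ and $Q_r(x)=f(x)+\frac r2\sum_i c_i(x)^2$. Let $\tilde\nabla f(x,\xi)$, $\tilde\nabla c_i(x,\zeta)$ be unbiased stochastic gradients: $\mathbb E\tilde\nabla f(x,\xi)=\nabla f(x)$ and $\mathbb E\tilde\nabla c_i(x,\zeta)=\nabla c_i(x)$ for $x\in X$. For $B=(\xi,\zeta^1,\zeta^2)$ put $$\tilde\nabla Q_r(x,B)=\tilde\nabla f(x,\xi)+r\sum_{i=1}^m\tilde\nabla c_i(x,\zeta^1)\,\tilde c_i(x,\zeta^2).$$ Algorithm. Let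 $\rho>1$ and $$\eta_k=\frac1{9\tilde L\rho(k+1)^{3/5}},\qquad \rho_k=\rho k^{1/5},\qquad \alpha_{k+1}=\frac{72}{81(k+1)^{4/5}},$$ $$\tilde L^2=4\tilde L_{\nabla f}^2+4m^2\big(\tilde C_c^2\tilde L_{\nabla c}^2+\tilde C_{\nabla c}^2\tilde L_c^2\big),\qquad \tilde L>0 .$$ Let $B_k=(\xi_k,\zeta^1_k,\zeta^2_k)$, $k\ge1$, be independent, with $\xi_k$ distributed as $\xi$ and $\zeta^1_k,\zeta^2_k$ independent of each other and distributed as $\zeta$. Start from a deterministic $x_1\in X$ and $g_1=\tilde\nabla Q_{\rho_1}(x_1,B_1)$, and for $k\ge1$ set $$x_{k+1}=P_X(x_k-\eta_kg_k),\qquad g_{k+1}=\tilde\nabla Q_{\rho_{k+1}}(x_{k+1},B_{k+1})+(1-\alpha_{k+1})\big(g_k-\tilde\nabla Q_{\rho_k}(x_k,B_{k+1})\big).$$ Assumptions. For all $x,y\in X$ and $i\in\{1,\dots,m\}$: (A2) $\mathbb E\|\tilde\nabla f(x,\xi)-\tilde\nabla f(y,\xi)\|^2\le\tilde L_{\nabla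 f}^2\|x-y\|^2$, $\ \mathbb E\|\tilde\nabla c_i(x,\zeta)-\tilde\nabla c_i(y,\zeta)\|^2\le\tilde L_{\nabla c}^2\|x-y\|^2$, $\ \mathbb E|\tilde c_i(x,\zeta)-\tilde c_i(y,\zeta)|^2\le\tilde L_c^2\|x-y\|^2$; (A3) $\mathbb E\|\tilde\nabla f(x,\xi)-\nabla f(x)\|^2\le\sigma_f^2$, $\ \mathbb E\|\tilde\nabla c_i(x,\zeta)-\nabla c_i(x)\|^2\le\sigma_{\nabla c}^2$, $\ \mathbb E|\tilde c_i(x,\zeta)-c_i(x)|^2\le\sigma_c^2$; (A4) $\|\nabla c_i(x)\|\le C_{\nabla c}$, $|c_i(x)|\le C_c$, almost surely $\|\tilde\nabla c_i(x,\zeta)\|\le\tilde C_{\nabla c}$ and $|\tilde c_i(x,\zeta)|\le\tilde C_c$, $\|\nabla f(x)\|\le C_{\nabla f}$, $Q_r(x)\ge\underline Q>-\infty$ for all $r>0$, and almost surely $|f(x_k)|\le B_f$ for all $k\ge1$; (A5) for some $\delta>0$, almost surely $\mathsf d\big(\nabla c(x_k)^\top c(x_k),-N_X(x_k)\big)\ge\delta\|c(x_k)\|$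 for all $k\ge1$. Conclusion. There are constants $A>0$ and $p\in\mathbb N$, depending only on $m$, $\rho$, $\delta$ and the constants in (A2)–(A4), such that for every $\varepsilon\in(0,1]$ and every integer $K\ge A\,\varepsilon^{-5}(1+\log(1/\varepsilon))^p$ the following holds. If $\hat k$ is uniform on $\{1,\dots,K\}$ and independent of the run of the algorithm, there is a random vector $\lambda\in\mathbb R^m$ with $$\mathbb E\,\mathsf d\big(\nabla f(x_{\hat k+1})+\nabla c(x_{\hat k+1})^\top\lambda,\,-N_X(x_{\hat k+1})\big)\le\varepsilon\qquad\text{and}\qquad\mathbb E\|c(x_{\hat k+1})\|\le\varepsilon .$$ In particular $\tilde O(\varepsilon^{-5})$ iterations suffice. -/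

import Mathlib

open MeasureTheory ProbabilityTheory

namespace StochPenalty

/-- `ℝⁿ` with the Euclidean norm. -/
abbrev Vec (n : ℕ) : Type := EuclideanSpace ℝ (Fin n)

/-- Normal cone of convex analysis (used only at points `x ∈ X`). -/
def normalCone {d : ℕ} (X : Set (Vec d)) (x : Vec d) : Set (Vec d) :=
  {v | ∀ y ∈ X, inner ℝ v (y - x) ≤ 0}

/-- The distance `𝖽(v, -N_X(x))`. -/
noncomputable def distNegNormal {d : ℕ} (X : Set (Vec d)) (x v : Vec d) : ℝ :=
  Metric.infDist v {w | -w ∈ normalCone X x}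

/-- `p` is the Euclidean projection `P_X(v)`. -/
def IsProj {d : ℕ} (X : Set (Vec d)) (v p : Vec d) : Prop :=
  p ∈ X ∧ ∀ y ∈ X, ‖v - p‖ ≤ ‖v - y‖

/-- Data of the problem `min_{x ∈ X} E[f̃(x, ξ)]` subject to `E[c̃(x, ζ)] = 0`, with first-order
stochastic oracles for the objective and for each constraint function. -/
structure Problem (d m : ℕ) (Ξ Z : Type*) [MeasurableSpace Ξ] [MeasurableSpace Z] where
  /-- constraint set -/
  X : Set (Vec d)
  /-- law of `ξ` -/
  lawXi : Measure Ξ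
  /-- law of `ζ` -/
  lawZeta : Measure Z
  /-- stochastic objective `f̃(x, ξ)` -/
  fT : Vec d → Ξ → ℝ
  /-- stochastic constraint map `c̃(x, ζ)` -/
  cT : Vec d → Z → Vec m
  /-- stochastic gradient `∇̃f(x, ξ)` -/
  gradF : Vec d → Ξ → Vec d
  /-- stochastic gradients `∇̃cᵢ(x, ζ)` -/
  gradC : Fin m → Vec d → Z → Vec d

/-- The numerical constants that appear in the assumptions. -/
structure Constants where
  /-- mean-square Lipschitz constant of `∇̃f` -/
  Lgf : ℝ
  /-- mean-square Lipschitz constant of the `∇̃cᵢ` -/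
  Lgc : ℝ
  /-- mean-square Lipschitz constant of the `c̃ᵢ` -/
  Lc : ℝ
  /-- standard deviation bound for `∇̃f` -/
  σf : ℝ
  /-- standard deviation bound for the `∇̃cᵢ` -/
  σgc : ℝ
  /-- standard deviation bound for the `c̃ᵢ` -/
  σc : ℝ
  /-- bound on `‖∇cᵢ‖` -/
  Cgc : ℝ
  /-- bound on `|cᵢ|` -/
  Cc : ℝ
  /-- bound on `‖∇̃cᵢ‖` -/
  CTgc : ℝ
  /-- bound on `|c̃ᵢ|` -/
  CTc : ℝ
  /-- bound on `|f|` along the iterates -/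
  Bf : ℝ
  /-- bound on `‖∇f‖` -/
  Cgf : ℝ
  /-- lower bound on the penalty functions -/
  Qlow : ℝ
  /-- regularity constant -/
  δ : ℝ

/-- `L̃ = (4 L̃_{∇f}² + 4 m² (C̃_c² L̃_{∇c}² + C̃_{∇c}² L̃_c²))^{1/2}`. -/
noncomputable def Constants.Lt (κ : Constants) (m : ℕ) : ℝ :=
  √(4 * κ.Lgf ^ 2 + 4 * (m : ℝ) ^ 2 * (κ.CTc ^ 2 * κ.Lgc ^ 2 + κ.CTgc ^ 2 * κ.Lc ^ 2))

/-- Step size `η_k = 1 / (9 L̃ ρ (k+1)^{3/5})`. -/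
noncomputable def stepSize (Lt ρ : ℝ) (k : ℕ) : ℝ :=
  1 / (9 * Lt * ρ * ((k : ℝ) + 1) ^ (3 / 5 : ℝ))

/-- Penalty parameter `ρ_k = ρ k^{1/5}`. -/
noncomputable def penalty (ρ : ℝ) (k : ℕ) : ℝ := ρ * (k : ℝ) ^ (1 / 5 : ℝ)

/-- Momentum parameter `α_k = 72 / (81 k^{4/5})`. -/
noncomputable def momentum (k : ℕ) : ℝ := 72 / (81 * (k : ℝ) ^ (4 / 5 : ℝ))

namespace Problem

variable {d m : ℕ} {Ξ Z : Type*} [MeasurableSpace Ξ] [MeasurableSpace Z]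

/-- `f(x) = E[f̃(x, ξ)]`. -/
noncomputable def f (P : Problem d m Ξ Z) (x : Vec d) : ℝ := ∫ ξ, P.fT x ξ ∂P.lawXi

/-- `c(x) = E[c̃(x, ζ)]`. -/
noncomputable def c (P : Problem d m Ξ Z) (x : Vec d) : Vec m := ∫ ζ, P.cT x ζ ∂P.lawZeta

/-- `∇cᵢ(x)`. -/
noncomputable def nablaC (P : Problem d m Ξ Z) (i : Fin m) (x : Vec d) : Vec d :=
  gradient (fun y => P.c y i) x

/-- `∇c(x)ᵀ l = ∑ᵢ lᵢ ∇cᵢ(x)`. -/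
noncomputable def jacT (P : Problem d m Ξ Z) (x : Vec d) (l : Vec m) : Vec d :=
  ∑ i, l i • P.nablaC i x

/-- Quadratic penalty function `Q_ρ(x) = f(x) + (ρ/2) ∑ᵢ cᵢ(x)²`. -/
noncomputable def Q (P : Problem d m Ξ Z) (r : ℝ) (x : Vec d) : ℝ :=
  P.f x + r / 2 * ∑ i, (P.c x i) ^ 2

/-- Stochastic oracle
`∇̃Q_ρ(x, B) = ∇̃f(x, ξ) + ρ ∑ᵢ c̃ᵢ(x, ζ²) ∇̃cᵢ(x, ζ¹)` for `B = (ξ, ζ¹, ζ²)`. -/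
noncomputable def gradQ (P : Problem d m Ξ Z) (r : ℝ) (x : Vec d) (B : Ξ × Z × Z) : Vec d :=
  P.gradF x B.1 + r • ∑ i, P.cT x B.2.2 i • P.gradC i x B.2.1

/-- The standing setting: `X` closed and convex, `f` and `cᵢ` well-defined expectations that are
differentiable at the points of `X`, measurable and unbiased oracles. -/
structure Standing (P : Problem d m Ξ Z) : Prop where
  closed : IsClosed P.X
  convex : Convex ℝ P.X
  probXi : IsProbabilityMeasure P.lawXi
  probZeta : IsProbabilityMeasure P.lawZeta
  integrable_fT : ∀ x, Integrable (P.fT x) P.lawXi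
  integrable_cT : ∀ x, Integrable (P.cT x) P.lawZeta
  measurable_cT : Measurable (Function.uncurry P.cT)
  measurable_gradF : Measurable (Function.uncurry P.gradF)
  measurable_gradC : ∀ i, Measurable (Function.uncurry (P.gradC i))
  differentiable_f : ∀ x ∈ P.X, DifferentiableAt ℝ P.f x
  differentiable_c : ∀ x ∈ P.X, ∀ i, DifferentiableAt ℝ (fun y => P.c y i) x
  integrable_gradF : ∀ x ∈ P.X, Integrable (P.gradF x) P.lawXi
  unbiased_gradF : ∀ x ∈ P.X, ∫ ξ, P.gradF x ξ ∂P.lawXi = gradient P.f x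
  integrable_gradC : ∀ x ∈ P.X, ∀ i, Integrable (P.gradC i x) P.lawZeta
  unbiased_gradC : ∀ x ∈ P.X, ∀ i, ∫ ζ, P.gradC i x ζ ∂P.lawZeta = P.nablaC i x

/-- Mean-square smoothness. -/
structure MeanSquareSmooth (P : Problem d m Ξ Z) (κ : Constants) : Prop where
  gradF : ∀ x ∈ P.X, ∀ y ∈ P.X,
    ∫⁻ ξ, ENNReal.ofReal (‖P.gradF x ξ - P.gradF y ξ‖ ^ 2) ∂P.lawXi
      ≤ ENNReal.ofReal (κ.Lgf ^ 2 * ‖x - y‖ ^ 2)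
  gradC : ∀ x ∈ P.X, ∀ y ∈ P.X, ∀ i,
    ∫⁻ ζ, ENNReal.ofReal (‖P.gradC i x ζ - P.gradC i y ζ‖ ^ 2) ∂P.lawZeta
      ≤ ENNReal.ofReal (κ.Lgc ^ 2 * ‖x - y‖ ^ 2)
  cT : ∀ x ∈ P.X, ∀ y ∈ P.X, ∀ i,
    ∫⁻ ζ, ENNReal.ofReal (|P.cT x ζ i - P.cT y ζ i| ^ 2) ∂P.lawZeta
      ≤ ENNReal.ofReal (κ.Lc ^ 2 * ‖x - y‖ ^ 2)

/-- Variance bounds. -/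
structure VarianceBounds (P : Problem d m Ξ Z) (κ : Constants) : Prop where
  gradF : ∀ x ∈ P.X,
    ∫⁻ ξ, ENNReal.ofReal (‖P.gradF x ξ - gradient P.f x‖ ^ 2) ∂P.lawXi
      ≤ ENNReal.ofReal (κ.σf ^ 2)
  gradC : ∀ x ∈ P.X, ∀ i,
    ∫⁻ ζ, ENNReal.ofReal (‖P.gradC i x ζ - P.nablaC i x‖ ^ 2) ∂P.lawZeta
      ≤ ENNReal.ofReal (κ.σgc ^ 2)
  cT : ∀ x ∈ P.X, ∀ i,
    ∫⁻ ζ, ENNReal.ofReal (|P.cT x ζ i - P.c x i| ^ 2) ∂P.lawZeta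
      ≤ ENNReal.ofReal (κ.σc ^ 2)

/-- Boundedness assumptions that concern the problem functions on `X`. -/
structure Bounds (P : Problem d m Ξ Z) (κ : Constants) : Prop where
  nablaC : ∀ x ∈ P.X, ∀ i, ‖P.nablaC i x‖ ≤ κ.Cgc
  c : ∀ x ∈ P.X, ∀ i, |P.c x i| ≤ κ.Cc
  gradC : ∀ x ∈ P.X, ∀ i, ∀ᵐ ζ ∂P.lawZeta, ‖P.gradC i x ζ‖ ≤ κ.CTgc
  cT : ∀ x ∈ P.X, ∀ i, ∀ᵐ ζ ∂P.lawZeta, |P.cT x ζ i| ≤ κ.CTc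
  nablaF : ∀ x ∈ P.X, ‖gradient P.f x‖ ≤ κ.Cgf
  Q : ∀ r : ℝ, 0 < r → ∀ x ∈ P.X, κ.Qlow ≤ P.Q r x

/-- `B_1, B_2, …` are independent samples `B_k = (ξ_k, ζ¹_k, ζ²_k)`, where `ξ_k` has the law of `ξ`,
and `ζ¹_k`, `ζ²_k` are independent with the law of `ζ`. (`B 0` is not used.) -/
structure IsSampling (P : Problem d m Ξ Z) {Ω : Type*} [MeasurableSpace Ω] (μ : Measure Ω)
    (B : ℕ → Ω → Ξ × Z × Z) : Prop where
  measurable : ∀ k, 1 ≤ k → Measurable (B k)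
  indep : iIndepFun (fun k : ℕ => B (k + 1)) μ
  law_xi : ∀ k, 1 ≤ k → μ.map (fun ω => (B k ω).1) = P.lawXi
  law_zeta₁ : ∀ k, 1 ≤ k → μ.map (fun ω => (B k ω).2.1) = P.lawZeta
  law_zeta₂ : ∀ k, 1 ≤ k → μ.map (fun ω => (B k ω).2.2) = P.lawZeta
  indep_zeta : ∀ k, 1 ≤ k → IndepFun (fun ω => (B k ω).2.1) (fun ω => (B k ω).2.2) μ

/-- `(x_k, g_k)_{k ≥ 1}` are the iterates of the stochastic linearized quadratic penalty method with
variance reduction, driven by the samples `B_k`, from the deterministic point `x_1 = x₁ ∈ X`, with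
step sizes `η`, penalty parameters `r` and momentum parameters `a`.
(The values `x 0`, `g 0` are not used.) -/
structure IsRun (P : Problem d m Ξ Z) {Ω : Type*} (B : ℕ → Ω → Ξ × Z × Z)
    (η r a : ℕ → ℝ) (x₁ : Vec d) (x g : ℕ → Ω → Vec d) : Prop where
  mem : x₁ ∈ P.X
  x_one : ∀ ω, x 1 ω = x₁
  g_one : ∀ ω, g 1 ω = P.gradQ (r 1) x₁ (B 1 ω)
  x_succ : ∀ k, 1 ≤ k → ∀ ω, IsProj P.X (x k ω - η k • g k ω) (x (k + 1) ω)
  g_succ : ∀ k, 1 ≤ k → ∀ ω, g (k + 1) ω = P.gradQ (r (k + 1)) (x (k + 1) ω) (B (k + 1) ω)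
    + (1 - a (k + 1)) • (g k ω - P.gradQ (r k) (x k ω) (B (k + 1) ω))

end Problem

end StochPenalty

/-! ### Arithmetic of the schedule `k^{1/5}` and of the final rate -/

namespace StochPenalty

/-! Write `t = (k+1)^{1/5}` and `a = L̃ρ`. Then the inverse step size is `9at³`, the momentum is
`(8/9)t⁻⁴` and the penalty is of order `t`. The multiplier is `λ = ρ_k c(x_{k+1})`, so that the
vector tested against the normal cone is the gradient of `Q_{ρ_k}` at `x_{k+1}`; its distance to the
negative normal cone is called the residual.

Three second moments are followed: the error `E` of the gradient estimator, the squared step `S`,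
and the squared violation `w`. Conditionally on the past, the new error is `1 - α` times the old one
plus centred noise, so squares add without a cross term (`l2Le_estimator`, integrated over the past
by `L2Le.of_indep`). The projected step lowers the penalty function by a multiple of `at³S`, up to
`E/(at³)` and a drift `t⁻⁴w` caused by the growth of the penalty (`descent_pointwise`). Optimality
of the projection bounds the squared residual by `200a²t⁶S + 2E` in mean (`l2Le_residual`), and the
regularity condition turns this into a bound of order `t⁻²` times (residual squared plus a constant)
for `w` (`violation_pointwise`). All of this is collected in `momentRecursion`.

What remains is deterministic. The potential `q + k^{1/5}E/(4a)` decreases by `2at³S + E/(24at³)`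
per step, up to a multiple of `t⁻⁵ = 1/(k+1)` (`potential_step`). The point is the drift: bounding
`w` by a constant would leave `t⁻⁴`, whose sum grows like `K^{1/5}`, whereas inserting the violation
bound makes it absorbable up to `t⁻⁵` (`drift_le`). Summation costs only a logarithm. Multiplying
the summands by `t³ ≤ (K+1)^{3/5}` shows that the squared residuals sum to `O(K^{3/5} log K)`, and
the violation bound gives the same for `w` (`sum_le`, `sum_violation_le`). The averages are thus
`O(K^{-2/5} log K)`, which is at most `ε²` once `K` is of order `ε⁻⁵` up to logarithms
(`sum_rate_le`); passing from second to first moments finishes the proof. -/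

/-- `k^{1/5}`, the basic rate of the penalty schedule. -/
noncomputable def fifthRoot (k : ℕ) : ℝ := (k : ℝ) ^ (1 / 5 : ℝ)

theorem fifthRoot_nonneg (k : ℕ) : 0 ≤ fifthRoot k := by unfold fifthRoot; positivity

theorem fifthRoot_pow_five (k : ℕ) : fifthRoot k ^ 5 = k := by
  unfold fifthRoot
  rw [← Real.rpow_natCast, ← Real.rpow_mul (Nat.cast_nonneg k)]
  norm_num

theorem one_le_fifthRoot {k : ℕ} (hk : 1 ≤ k) : 1 ≤ fifthRoot k :=
  Real.one_le_rpow (by exact_mod_cast hk) (by norm_num)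

theorem fifthRoot_mono {j k : ℕ} (h : j ≤ k) : fifthRoot j ≤ fifthRoot k :=
  Real.rpow_le_rpow (Nat.cast_nonneg j) (by exact_mod_cast h) (by norm_num)

/-- Since `k + 1 ≤ 2k`, the claim holds for the fifth power; a failure at a smaller power would
propagate to the fifth by monotonicity. -/
theorem half_fifthRoot_succ_le {k : ℕ} (hk : 1 ≤ k) (j : ℕ) (hj : j ≤ 5) :
    fifthRoot (k + 1) ^ j ≤ 2 * fifthRoot k ^ j := by
  have hs := one_le_fifthRoot hk
  have ht := one_le_fifthRoot (show 1 ≤ k + 1 by omega)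
  have h5 : fifthRoot (k + 1) ^ 5 ≤ 2 * fifthRoot k ^ 5 := by
    rw [fifthRoot_pow_five, fifthRoot_pow_five]
    have : (1 : ℝ) ≤ k := by exact_mod_cast hk
    push_cast; linarith
  by_contra! hlt
  have hle : fifthRoot k ^ (5 - j) ≤ fifthRoot (k + 1) ^ (5 - j) :=
    pow_le_pow_left₀ (fifthRoot_nonneg k) (fifthRoot_mono (Nat.le_succ k)) _
  have hpos : 0 < fifthRoot k ^ (5 - j) := by positivity
  have h1 : fifthRoot (k + 1) ^ 5 = fifthRoot (k + 1) ^ j * fifthRoot (k + 1) ^ (5 - j) := by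
    rw [← pow_add]; congr 1; omega
  have h2 : fifthRoot k ^ 5 = fifthRoot k ^ j * fifthRoot k ^ (5 - j) := by
    rw [← pow_add]; congr 1; omega
  rw [h1, h2] at h5
  have h3 := mul_lt_mul_of_pos_right hlt hpos
  have h4 := mul_le_mul_of_nonneg_left hle (show 0 ≤ fifthRoot (k + 1) ^ j by positivity)
  linarith

theorem fifthRoot_factor (k : ℕ) :
    (fifthRoot (k + 1) - fifthRoot k) * (fifthRoot (k + 1) ^ 4 + fifthRoot (k + 1) ^ 3 * fifthRoot k
      + fifthRoot (k + 1) ^ 2 * fifthRoot k ^ 2 + fifthRoot (k + 1) * fifthRoot k ^ 3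
      + fifthRoot k ^ 4) = 1 := by
  have h1 := fifthRoot_pow_five (k + 1)
  have h2 := fifthRoot_pow_five k
  push_cast at h1
  linear_combination h1 - h2

/-- In the factorization of `t⁵ - s⁵ = 1` the term `t⁴` counts fully and each of the other four is
at least `t⁴/2`, whence the `3`. -/
theorem fifthRoot_diff_mul_le {k : ℕ} (hk : 1 ≤ k) :
    (fifthRoot (k + 1) - fifthRoot k) * (3 * fifthRoot (k + 1) ^ 4) ≤ 1 := by
  rw [← fifthRoot_factor k]
  have hd : 0 ≤ fifthRoot (k + 1) - fifthRoot k := sub_nonneg.2 (fifthRoot_mono (Nat.le_succ k))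
  have ht := fifthRoot_nonneg (k + 1)
  refine mul_le_mul_of_nonneg_left ?_ hd
  have h1 := mul_le_mul_of_nonneg_left (half_fifthRoot_succ_le hk 1 (by norm_num))
    (pow_nonneg ht 3)
  have h2 := mul_le_mul_of_nonneg_left (half_fifthRoot_succ_le hk 2 (by norm_num))
    (pow_nonneg ht 2)
  have h3 := mul_le_mul_of_nonneg_left (half_fifthRoot_succ_le hk 3 (by norm_num)) ht
  have h4 := half_fifthRoot_succ_le hk 4 (by norm_num)
  linarith

theorem fifthRoot_diff_le {k : ℕ} (hk : 1 ≤ k) :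
    fifthRoot (k + 1) - fifthRoot k ≤ (fifthRoot (k + 1) ^ 4)⁻¹ / 3 := by
  have ht := one_le_fifthRoot (show 1 ≤ k + 1 by omega)
  have := fifthRoot_diff_mul_le hk
  rw [inv_eq_one_div, div_div, le_div_iff₀ (by positivity)]
  linarith

/-- A telescoping majorant. Each of the five terms in the factorization of `t⁵ - s⁵ = 1` is at most
`t⁴`, so `t - s ≥ 1/(5t⁴)`, and `t³ - s³ ≥ (t - s)t²`. -/
theorem inv_sq_fifthRoot_le (k : ℕ) :
    (fifthRoot (k + 1) ^ 2)⁻¹ ≤ 5 * (fifthRoot (k + 1) ^ 3 - fifthRoot k ^ 3) := by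
  have ht := one_le_fifthRoot (show 1 ≤ k + 1 by omega)
  have hs := fifthRoot_nonneg k
  have hst := fifthRoot_mono (Nat.le_succ k)
  have hf := fifthRoot_factor k
  set t := fifthRoot (k + 1)
  set s := fifthRoot k
  have hst : s ≤ t := hst
  have ht0 : 0 ≤ t := by linarith
  have h5 : 1 ≤ (t - s) * (5 * t ^ 4) := by
    rw [← hf]
    refine mul_le_mul_of_nonneg_left ?_ (by linarith)
    have h1 : t ^ 3 * s ≤ t ^ 3 * t := by gcongr
    have h2 : t ^ 2 * s ^ 2 ≤ t ^ 2 * t ^ 2 := by gcongr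
    have h3 : t * s ^ 3 ≤ t * t ^ 3 := by gcongr
    have h4 : s ^ 4 ≤ t ^ 4 := by gcongr
    nlinarith
  rw [inv_le_iff_one_le_mul₀ (by positivity)]
  have : (t - s) * (t ^ 2 * t ^ 2) ≤ (t ^ 3 - s ^ 3) * t ^ 2 := by
    have : (t ^ 3 - s ^ 3) * t ^ 2 - (t - s) * (t ^ 2 * t ^ 2)
      = (t - s) * (t * s + s ^ 2) * t ^ 2 := by ring
    have h : 0 ≤ (t - s) * (t * s + s ^ 2) * t ^ 2 :=
      mul_nonneg (mul_nonneg (by linarith) (by positivity)) (by positivity)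
    linarith
  nlinarith

/-- The iteration count needed to make `T³ (1 + log T⁵)` negligible against `ε² T⁵`. -/
theorem log_rate_le {C ε A' T : ℝ} (hC : 0 ≤ C) (hε : 0 < ε) (hε1 : ε ≤ 1) (hA : 42 * C + 1 ≤ A')
    (hT : A' * (1 / ε) * (1 + Real.log (1 / ε)) ≤ T) :
    2 * C * (1 + 5 * Real.log T) ≤ ε ^ 2 * T ^ 2 := by
  have hA1 : 1 ≤ A' := by linarith
  have hlog : 0 ≤ Real.log (1 / ε) := Real.log_nonneg (by rw [le_div_iff₀ hε]; linarith)
  set l := 1 + Real.log (1 / ε) with hl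
  have hl1 : 1 ≤ l := by linarith
  have h0 : 0 < A' * (1 / ε) * l := by positivity
  -- The factorization `T = A' · (1/ε) · l · u` with all factors at least `1` splits `log T` into
  -- four logarithms, while `εT = A'lu`. Three of the logarithms are bounded by `log y ≤ y - 1`; the
  -- fourth, `log (1/ε)`, is `l - 1`.
  set u := T / (A' * (1 / ε) * l) with hu
  have hu1 : 1 ≤ u := by rw [hu, le_div_iff₀ h0]; linarith
  have hTu : T = A' * (1 / ε) * l * u := by rw [hu]; field_simp
  have hεT : ε ^ 2 * T ^ 2 = A' ^ 2 * (l ^ 2 * u ^ 2) := by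
    rw [hTu]; field_simp
  have hlogT : Real.log T = Real.log A' + Real.log (1 / ε) + Real.log l + Real.log u := by
    rw [hTu, Real.log_mul (by positivity) (by positivity), Real.log_mul (by positivity)
      (by positivity), Real.log_mul (by positivity) (by positivity)]
  have h1 : Real.log A' ≤ A' - 1 := Real.log_le_sub_one_of_pos (by linarith)
  have h2 : Real.log l ≤ l - 1 := Real.log_le_sub_one_of_pos (by linarith)
  have h3 : Real.log u ≤ u - 1 := Real.log_le_sub_one_of_pos (by linarith)
  have hlu : 1 ≤ l * u := by nlinarith
  have hlu2 : l * u ≤ l ^ 2 * u ^ 2 := by nlinarith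
  have hl2 : l ≤ l * u := by nlinarith
  have hu2 : u ≤ l * u := by nlinarith
  have h4 : 1 + 5 * Real.log T ≤ 21 * A' * (l ^ 2 * u ^ 2) := by
    have : 1 + 5 * Real.log T ≤ 5 * A' + 10 * l + 5 * u := by rw [hlogT]; linarith
    have : 5 * A' ≤ 5 * A' * (l * u) := by nlinarith
    have : l * u ≤ A' * (l * u) := by nlinarith
    have : A' * (l * u) ≤ A' * (l ^ 2 * u ^ 2) := by gcongr
    nlinarith
  rw [hεT]
  calc 2 * C * (1 + 5 * Real.log T) ≤ 2 * C * (21 * A' * (l ^ 2 * u ^ 2)) := by gcongr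
    _ = (42 * C) * A' * (l ^ 2 * u ^ 2) := by ring
    _ ≤ A' * A' * (l ^ 2 * u ^ 2) := by gcongr; linarith
    _ = _ := by ring

/-! ### The deterministic recursion and its potential function -/

/-- Recursive inequalities satisfied by the second moments along a run: `q` is the expected penalty,
`E` the gradient error, `S` the squared step length, and `w` the squared constraint violation. -/
structure MomentRecursion (a ρ δ C₁ G W : ℝ) (q E S w : ℕ → ℝ) : Prop where
  E_nonneg : ∀ k, 1 ≤ k → 0 ≤ E k
  S_nonneg : ∀ k, 1 ≤ k → 0 ≤ S k
  error : ∀ k, 1 ≤ k → E (k + 1) ≤ (1 - 8 / 9 * (fifthRoot (k + 1) ^ 4)⁻¹) * E k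
    + C₁ * (fifthRoot (k + 1) ^ 6)⁻¹ + 4 * a ^ 2 * fifthRoot (k + 1) ^ 2 * S k
  descent : ∀ k, 1 ≤ k → q (k + 1) ≤ q k - 7 / 2 * a * fifthRoot (k + 1) ^ 3 * S k
    + (fifthRoot (k + 1) ^ 3)⁻¹ / (18 * a) * E k + ρ / 2 * (fifthRoot (k + 1) ^ 4)⁻¹ * w (k + 1)
  violation : ∀ k, 1 ≤ k → w (k + 1) ≤ 4 / δ ^ 2 * (fifthRoot (k + 1) ^ 2)⁻¹ *
    (200 * a ^ 2 * fifthRoot (k + 1) ^ 6 * S k + 2 * E k + G)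
  violation_le : ∀ k, 1 ≤ k → w (k + 1) ≤ W

namespace MomentRecursion

variable {a ρ δ C₁ G W : ℝ} {q E S w : ℕ → ℝ}

/-- The cost of raising the penalty must be summable up to a logarithm. The regularity bound on `w`
brings an extra `t⁻²`, so for large `t` the `S` and `E` parts fit into the decrease of the potential
and only `O(t⁻⁶)` is left. -/
theorem drift_le (h : MomentRecursion a ρ δ C₁ G W q E S w) (ha : 0 < a) (hρ : 0 < ρ)
    (hG : 0 ≤ G) (hW : 0 ≤ W) {k : ℕ} (hk : 1 ≤ k) :
    ρ / 2 * (fifthRoot (k + 1) ^ 4)⁻¹ * w (k + 1) ≤ a / 2 * fifthRoot (k + 1) ^ 3 * S k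
      + (fifthRoot (k + 1) ^ 3)⁻¹ / (24 * a) * E k
      + (2 * ρ / δ ^ 2 * G + ρ / 2 * W * (400 * a * (2 * ρ / δ ^ 2) + 1))
        * (fifthRoot (k + 1) ^ 5)⁻¹ := by
  have ht := one_le_fifthRoot (show 1 ≤ k + 1 by omega)
  have hE := h.E_nonneg k hk
  have hS := h.S_nonneg k hk
  have hw := h.violation k hk
  have hw' := h.violation_le k hk
  set t := fifthRoot (k + 1)
  have hB : 0 ≤ 2 * ρ / δ ^ 2 := by positivity
  have hB' : 4 / δ ^ 2 * (ρ / 2) = 2 * ρ / δ ^ 2 := by ring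
  set D := 2 * ρ / δ ^ 2 with hD
  have ht0 : 0 < t := by linarith
  have ht3 : t ≤ t ^ 3 := by nlinarith [mul_nonneg ht0.le (show 0 ≤ t ^ 2 - 1 by nlinarith)]
  -- The threshold is dictated by the `S` part, `200a²D ≤ at³/2`; the `E` part needs only `48aD ≤
  -- t³`. Below the threshold `w ≤ W` suffices, because there `t⁻⁴ = t · t⁻⁵` is at most a constant
  -- times `t⁻⁵`.
  rcases le_or_gt (400 * a * D + 1) t with hT | hT
  · have h1 : ρ / 2 * (t ^ 4)⁻¹ * w (k + 1) ≤ ρ / 2 * (t ^ 4)⁻¹ * (4 / δ ^ 2 * (t ^ 2)⁻¹ *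
        (200 * a ^ 2 * t ^ 6 * S k + 2 * E k + G)) := by gcongr
    have h2 : ρ / 2 * (t ^ 4)⁻¹ * (4 / δ ^ 2 * (t ^ 2)⁻¹ *
        (200 * a ^ 2 * t ^ 6 * S k + 2 * E k + G))
        = D * 200 * a ^ 2 * S k + 2 * D * (t ^ 6)⁻¹ * E k + D * G * (t ^ 6)⁻¹ := by
      rw [← hB']; field_simp
    have h3 : D * 200 * a ^ 2 * S k ≤ a / 2 * t ^ 3 * S k := by
      refine mul_le_mul_of_nonneg_right ?_ hS
      have := mul_le_mul_of_nonneg_left (show 400 * a * D ≤ t ^ 3 by linarith) ha.le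
      linarith
    have h4 : 2 * D * (t ^ 6)⁻¹ * E k ≤ (t ^ 3)⁻¹ / (24 * a) * E k := by
      gcongr
      have : t ^ 6 = t ^ 3 * t ^ 3 := by ring
      rw [this, mul_inv, ← mul_assoc, div_eq_inv_mul]
      gcongr
      rw [← div_eq_mul_inv, div_le_iff₀ (by positivity), inv_mul_eq_div,
        le_div_iff₀ (by positivity)]
      nlinarith [mul_nonneg ha.le hB]
    have h5 : D * G * (t ^ 6)⁻¹ ≤ D * G * (t ^ 5)⁻¹ := by
      gcongr
      norm_num
    have h6 : 0 ≤ ρ / 2 * W * (400 * a * D + 1) * (t ^ 5)⁻¹ := by positivity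
    linarith
  · have h1 : ρ / 2 * (t ^ 4)⁻¹ * w (k + 1) ≤ ρ / 2 * (t ^ 4)⁻¹ * W := by gcongr
    have h2 : (t ^ 4)⁻¹ = t * (t ^ 5)⁻¹ := by field_simp
    have h3 : ρ / 2 * (t ^ 4)⁻¹ * W ≤ ρ / 2 * W * (400 * a * D + 1) * (t ^ 5)⁻¹ := by
      rw [h2]
      have : ρ / 2 * W * (t ^ 5)⁻¹ * t ≤ ρ / 2 * W * (t ^ 5)⁻¹ * (400 * a * D + 1) := by gcongr
      linarith
    have h4 : 0 ≤ a / 2 * t ^ 3 * S k := by positivity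
    have h5 : 0 ≤ (t ^ 3)⁻¹ / (24 * a) * E k := by positivity
    have h6 : 0 ≤ D * G * (t ^ 5)⁻¹ := by positivity
    linarith

/-- One-step decrease of the potential `q k + k^{1/5} E k / (4a)`. -/
theorem potential_step (h : MomentRecursion a ρ δ C₁ G W q E S w) (ha : 0 < a) (hρ : 0 < ρ)
    (hG : 0 ≤ G) (hW : 0 ≤ W) {k : ℕ} (hk : 1 ≤ k) :
    q (k + 1) + fifthRoot (k + 1) / (4 * a) * E (k + 1)
      + 2 * a * (fifthRoot (k + 1) ^ 3 * S k) + (fifthRoot (k + 1) ^ 3)⁻¹ * E k / (24 * a)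
      ≤ q k + fifthRoot k / (4 * a) * E k
      + (C₁ / (4 * a) + (2 * ρ / δ ^ 2 * G + ρ / 2 * W * (400 * a * (2 * ρ / δ ^ 2) + 1)))
        * (fifthRoot (k + 1) ^ 5)⁻¹ := by
  have hd := h.drift_le ha hρ hG hW hk
  have hq := h.descent k hk
  have he := h.error k hk
  have hdiff := fifthRoot_diff_le hk
  have ht := one_le_fifthRoot (show 1 ≤ k + 1 by omega)
  have hE := h.E_nonneg k hk
  have hS := h.S_nonneg k hk
  set t := fifthRoot (k + 1)
  set s := fifthRoot k
  have ht0 : 0 < t := by linarith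
  set C₃ := 2 * ρ / δ ^ 2 * G + ρ / 2 * W * (400 * a * (2 * ρ / δ ^ 2) + 1)
  -- The budget is exact. In units of `at³S`: `7/2` from descent, minus `1` from the error
  -- recursion, minus `1/2` from the drift, leaves `2`. In units of `E/(at³)`: `2/9` from momentum,
  -- minus `1/12` for the growing weight, `1/18` from descent and `1/24` from the drift, leaves
  -- `1/24`.
  have e1 : t / (4 * a) * E (k + 1) ≤ t / (4 * a) * ((1 - 8 / 9 * (t ^ 4)⁻¹) * E k
    + C₁ * (t ^ 6)⁻¹ + 4 * a ^ 2 * t ^ 2 * S k) := by gcongr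
  have e2 : t / (4 * a) * ((1 - 8 / 9 * (t ^ 4)⁻¹) * E k
    + C₁ * (t ^ 6)⁻¹ + 4 * a ^ 2 * t ^ 2 * S k) = t / (4 * a) * E k
      - 2 / 9 * ((t ^ 3)⁻¹ / a * E k) + C₁ / (4 * a) * (t ^ 5)⁻¹ + a * (t ^ 3 * S k) := by
    field_simp; ring
  have e3 : t / (4 * a) * E k ≤ s / (4 * a) * E k + 1 / 12 * ((t ^ 3)⁻¹ / a * E k) := by
    have h4 : (t ^ 4)⁻¹ ≤ (t ^ 3)⁻¹ := by
      gcongr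
      norm_num
    have h5 : t ≤ s + (t ^ 3)⁻¹ / 3 := by linarith
    calc t / (4 * a) * E k ≤ (s + (t ^ 3)⁻¹ / 3) / (4 * a) * E k := by gcongr
      _ = _ := by field_simp; ring
  have e4 : (t ^ 3)⁻¹ / (18 * a) * E k = 1 / 18 * ((t ^ 3)⁻¹ / a * E k) := by field_simp
  have e5 : (t ^ 3)⁻¹ / (24 * a) * E k = 1 / 24 * ((t ^ 3)⁻¹ / a * E k) := by field_simp
  have e6 : (t ^ 3)⁻¹ * E k / (24 * a) = 1 / 24 * ((t ^ 3)⁻¹ / a * E k) := by field_simp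
  rw [e4] at hq
  rw [e5] at hd
  rw [e6]
  linarith

/-- Makes the remainders `1/(k+1)` telescope into a logarithm. -/
theorem one_div_succ_le_log_sub {k : ℕ} (hk : 1 ≤ k) :
    (fifthRoot (k + 1) ^ 5)⁻¹ ≤ Real.log ((k + 1 : ℕ) : ℝ) - Real.log (k : ℝ) := by
  have hk0 : (0 : ℝ) < k := by exact_mod_cast hk
  rw [fifthRoot_pow_five]
  push_cast
  have h := Real.one_sub_inv_le_log_of_pos (show 0 < ((k : ℝ) + 1) / k by positivity)
  rw [Real.log_div (by positivity) (by positivity)] at h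
  refine le_trans (le_of_eq ?_) h
  field_simp
  ring

theorem potential_sum (h : MomentRecursion a ρ δ C₁ G W q E S w) (ha : 0 < a) (hρ : 0 < ρ)
    (hC : 0 ≤ C₁) (hG : 0 ≤ G) (hW : 0 ≤ W) (K : ℕ) :
    q (K + 1) + fifthRoot (K + 1) / (4 * a) * E (K + 1)
      + ∑ k ∈ Finset.Icc 1 K, (2 * a * (fifthRoot (k + 1) ^ 3 * S k)
        + (fifthRoot (k + 1) ^ 3)⁻¹ * E k / (24 * a))
      ≤ q 1 + E 1 / (4 * a)
      + (C₁ / (4 * a) + (2 * ρ / δ ^ 2 * G + ρ / 2 * W * (400 * a * (2 * ρ / δ ^ 2) + 1)))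
        * Real.log ((K + 1 : ℕ) : ℝ) := by
  induction K with
  | zero =>
    have : fifthRoot 1 = 1 := by simp [fifthRoot]
    simp [this]
    field_simp
    rfl
  | succ K ih =>
    rw [Finset.sum_Icc_succ_top (by omega)]
    have h1 := h.potential_step ha hρ hG hW (show 1 ≤ K + 1 by omega)
    have h2 := one_div_succ_le_log_sub (show 1 ≤ K + 1 by omega)
    set C₄ := C₁ / (4 * a) + (2 * ρ / δ ^ 2 * G + ρ / 2 * W * (400 * a * (2 * ρ / δ ^ 2) + 1))
    have hC4 : 0 ≤ C₄ := by positivity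
    have h3 := mul_le_mul_of_nonneg_left h2 hC4
    linarith

/-- The averaged second moments are `O(K^{-2/5} (1 + log K))`. -/
theorem sum_le (h : MomentRecursion a ρ δ C₁ G W q E S w) (ha : 0 < a) (hρ : 0 < ρ)
    (hC : 0 ≤ C₁) (hG : 0 ≤ G) (hW : 0 ≤ W) {C₅ : ℝ} {Ql : ℝ} (hQl : ∀ k, 1 ≤ k → Ql ≤ q k)
    (hC₅ : q 1 - Ql + E 1 / (4 * a) ≤ C₅)
    (hC₅' : C₁ / (4 * a) + (2 * ρ / δ ^ 2 * G + ρ / 2 * W * (400 * a * (2 * ρ / δ ^ 2) + 1)) ≤ C₅)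
    (K : ℕ) :
    ∑ k ∈ Finset.Icc 1 K, (200 * a ^ 2 * fifthRoot (k + 1) ^ 6 * S k + 2 * E k)
      ≤ 148 * a * C₅ * (fifthRoot (K + 1) ^ 3 * (1 + Real.log ((K + 1 : ℕ) : ℝ))) := by
  have h1 := h.potential_sum ha hρ hC hG hW K
  have hT := one_le_fifthRoot (show 1 ≤ K + 1 by omega)
  have hlog : 0 ≤ Real.log ((K + 1 : ℕ) : ℝ) := Real.log_natCast_nonneg _
  have h2 : ∑ k ∈ Finset.Icc 1 K, (2 * a * (fifthRoot (k + 1) ^ 3 * S k)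
        + (fifthRoot (k + 1) ^ 3)⁻¹ * E k / (24 * a))
      ≤ C₅ * (1 + Real.log ((K + 1 : ℕ) : ℝ)) := by
    have := hQl (K + 1) (by omega)
    have : 0 ≤ fifthRoot (K + 1) / (4 * a) * E (K + 1) :=
      mul_nonneg (by positivity) (h.E_nonneg _ (by omega))
    have := mul_le_mul_of_nonneg_right hC₅' hlog
    linarith
  have h3 : ∑ k ∈ Finset.Icc 1 K, (200 * a ^ 2 * fifthRoot (k + 1) ^ 6 * S k + 2 * E k)
      ≤ ∑ k ∈ Finset.Icc 1 K, 148 * a * fifthRoot (K + 1) ^ 3 *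
        (2 * a * (fifthRoot (k + 1) ^ 3 * S k) + (fifthRoot (k + 1) ^ 3)⁻¹ * E k / (24 * a)) := by
    refine Finset.sum_le_sum fun k hk => ?_
    rw [Finset.mem_Icc] at hk
    have ht := one_le_fifthRoot (show 1 ≤ k + 1 by omega)
    have htT : fifthRoot (k + 1) ^ 3 ≤ fifthRoot (K + 1) ^ 3 :=
      pow_le_pow_left₀ (by linarith) (fifthRoot_mono (by omega)) 3
    have hE := h.E_nonneg k hk.1
    have hS := h.S_nonneg k hk.1
    set t := fifthRoot (k + 1)
    set T := fifthRoot (K + 1)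
    have ht0 : 0 < t := by linarith
    -- The `S` part needs a factor of at least `100` and the `E` part at least `48`; their sum `148`
    -- covers both.
    calc 200 * a ^ 2 * t ^ 6 * S k + 2 * E k
        ≤ 148 * a * t ^ 3 * (2 * a * (t ^ 3 * S k) + (t ^ 3)⁻¹ * E k / (24 * a)) := by
          have : 148 * a * t ^ 3 * (2 * a * (t ^ 3 * S k) + (t ^ 3)⁻¹ * E k / (24 * a))
            = 296 * (a ^ 2 * t ^ 6 * S k) + 148 / 24 * E k := by field_simp; ring
          rw [this]
          have : 0 ≤ a ^ 2 * t ^ 6 * S k := by positivity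
          linarith
      _ ≤ _ := by gcongr
  rw [← Finset.mul_sum] at h3
  refine h3.trans ?_
  have := mul_le_mul_of_nonneg_left h2 (show 0 ≤ 148 * a * fifthRoot (K + 1) ^ 3 by positivity)
  linarith

theorem sum_inv_sq_fifthRoot_le (K : ℕ) :
    ∑ k ∈ Finset.Icc 1 K, (fifthRoot (k + 1) ^ 2)⁻¹ ≤ 5 * fifthRoot (K + 1) ^ 3 := by
  induction K with
  | zero => have := fifthRoot_nonneg 1; simp; positivity
  | succ K ih =>
    rw [Finset.sum_Icc_succ_top (by omega)]
    have := inv_sq_fifthRoot_le (K + 1)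
    linarith

/-- The residual part is bounded using only `t⁻² ≤ 1`; the constant part keeps its `t⁻²`, whose sum
is again of order `K^{3/5}`. -/
theorem sum_violation_le (h : MomentRecursion a ρ δ C₁ G W q E S w)
    (hG : 0 ≤ G) {C : ℝ} (K : ℕ)
    (hsum : ∑ k ∈ Finset.Icc 1 K, (200 * a ^ 2 * fifthRoot (k + 1) ^ 6 * S k + 2 * E k)
      ≤ C * (fifthRoot (K + 1) ^ 3 * (1 + Real.log ((K + 1 : ℕ) : ℝ)))) :
    ∑ k ∈ Finset.Icc 1 K, w (k + 1) ≤
      4 / δ ^ 2 * (C + 5 * G) * (fifthRoot (K + 1) ^ 3 * (1 + Real.log ((K + 1 : ℕ) : ℝ))) := by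
  have hT := one_le_fifthRoot (show 1 ≤ K + 1 by omega)
  have hlog : 0 ≤ Real.log ((K + 1 : ℕ) : ℝ) := Real.log_natCast_nonneg _
  have h1 : ∑ k ∈ Finset.Icc 1 K, w (k + 1) ≤ ∑ k ∈ Finset.Icc 1 K, 4 / δ ^ 2 *
      ((200 * a ^ 2 * fifthRoot (k + 1) ^ 6 * S k + 2 * E k)
        + G * (fifthRoot (k + 1) ^ 2)⁻¹) := by
    refine Finset.sum_le_sum fun k hk => ?_
    rw [Finset.mem_Icc] at hk
    refine (h.violation k hk.1).trans ?_
    rw [mul_assoc]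
    gcongr
    rw [mul_add, mul_comm G]
    gcongr
    have ht := one_le_fifthRoot (show 1 ≤ k + 1 by omega)
    have hE := h.E_nonneg k hk.1
    have hS := h.S_nonneg k hk.1
    refine mul_le_of_le_one_left (by positivity) (inv_le_one_of_one_le₀ (one_le_pow₀ ht))
  refine h1.trans ?_
  rw [← Finset.mul_sum, Finset.sum_add_distrib, ← Finset.mul_sum, mul_assoc]
  gcongr
  have h2 := mul_le_mul_of_nonneg_left (sum_inv_sq_fifthRoot_le K) hG
  have h3 : fifthRoot (K + 1) ^ 3 ≤ fifthRoot (K + 1) ^ 3 * (1 + Real.log ((K + 1 : ℕ) : ℝ)) :=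
    le_mul_of_one_le_right (by positivity) (by linarith)
  have h4 := mul_le_mul_of_nonneg_left h3 hG
  linarith

end MomentRecursion

/-- The condition on `K` is the fifth power of the one in `log_rate_le` for `T = (K+1)^{1/5}`; the
factor `2` there pays for `T⁵ = K + 1 ≤ 2K`. -/
theorem sum_rate_le {C ε A' : ℝ} (hC : 0 ≤ C) (hε : 0 < ε) (hε1 : ε ≤ 1) (hA : 42 * C + 1 ≤ A')
    {K : ℕ} (hK1 : 1 ≤ K) (hK : A' ^ 5 * (1 / ε) ^ 5 * (1 + Real.log (1 / ε)) ^ 5 ≤ (K : ℝ)) :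
    C * (fifthRoot (K + 1) ^ 3 * (1 + Real.log ((K + 1 : ℕ) : ℝ))) ≤ ε ^ 2 * K := by
  have hT := one_le_fifthRoot (show 1 ≤ K + 1 by omega)
  have h5 := fifthRoot_pow_five (K + 1)
  have hlog5 : Real.log ((K + 1 : ℕ) : ℝ) = 5 * Real.log (fifthRoot (K + 1)) := by
    rw [← h5, Real.log_pow]; norm_num
  rw [hlog5]
  set T := fifthRoot (K + 1)
  have hTge : A' * (1 / ε) * (1 + Real.log (1 / ε)) ≤ T := by
    refine le_of_pow_le_pow_left₀ (n := 5) (by norm_num) (by linarith) ?_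
    rw [h5, mul_pow, mul_pow]
    push_cast
    linarith
  have h1 := log_rate_le hC hε hε1 hA hTge
  have h2 : T ^ 5 ≤ 2 * K := by
    rw [h5]; push_cast
    have : (1 : ℝ) ≤ K := by exact_mod_cast hK1
    linarith
  have h3 := mul_le_mul_of_nonneg_left h1 (show 0 ≤ T ^ 3 by positivity)
  have h4 := mul_le_mul_of_nonneg_left h2 (show 0 ≤ ε ^ 2 by positivity)
  nlinarith

end StochPenalty

/-! ### Calculus of second-moment bounds -/

namespace StochPenalty

section L2

variable {α F : Type*} [MeasurableSpace α] [NormedAddCommGroup F] {β : Measure α}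

/-- `φ` is square integrable with `E ‖φ‖² ≤ c`. -/
structure L2Le (β : Measure α) (φ : α → F) (c : ℝ) : Prop where
  memLp : MemLp φ 2 β
  le : ∫ a, ‖φ a‖ ^ 2 ∂β ≤ c

theorem integrable_and_integral_le_of_lintegral {φ : α → ℝ} {c : ℝ}
    (hφ : AEStronglyMeasurable φ β) (h0 : ∀ a, 0 ≤ φ a) (hc : 0 ≤ c)
    (h : ∫⁻ a, ENNReal.ofReal (φ a) ∂β ≤ ENNReal.ofReal c) :
    Integrable φ β ∧ ∫ a, φ a ∂β ≤ c := by
  refine ⟨⟨hφ, ?_⟩, ?_⟩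
  · rw [hasFiniteIntegral_iff_ofReal (Filter.Eventually.of_forall h0)]
    exact h.trans_lt ENNReal.ofReal_lt_top
  · rw [integral_eq_lintegral_of_nonneg_ae (Filter.Eventually.of_forall h0) hφ]
    exact ENNReal.toReal_le_of_le_ofReal hc h

namespace L2Le

theorem integrable_sq {φ : α → F} {c : ℝ} (h : L2Le β φ c) :
    Integrable (fun a => ‖φ a‖ ^ 2) β :=
  (memLp_two_iff_integrable_sq_norm h.memLp.1).1 h.memLp

theorem nonneg {φ : α → F} {c : ℝ} (h : L2Le β φ c) : 0 ≤ c :=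
  le_trans (integral_nonneg fun _ => by positivity) h.le

theorem mono {φ : α → F} {c c' : ℝ} (h : L2Le β φ c) (hc : c ≤ c') : L2Le β φ c' :=
  ⟨h.memLp, h.le.trans hc⟩

theorem of_integrable_sq {φ : α → F} {c : ℝ} (hφ : AEStronglyMeasurable φ β)
    (hi : Integrable (fun a => ‖φ a‖ ^ 2) β) (hc : ∫ a, ‖φ a‖ ^ 2 ∂β ≤ c) : L2Le β φ c :=
  ⟨(memLp_two_iff_integrable_sq_norm hφ).2 hi, hc⟩

theorem of_lintegral {φ : α → F} {c : ℝ} (hφ : AEStronglyMeasurable φ β) (hc : 0 ≤ c)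
    (h : ∫⁻ a, ENNReal.ofReal (‖φ a‖ ^ 2) ∂β ≤ ENNReal.ofReal c) : L2Le β φ c := by
  have := integrable_and_integral_le_of_lintegral (hφ.norm.pow 2)
    (fun a => sq_nonneg ‖φ a‖) hc h
  exact of_integrable_sq hφ this.1 this.2

theorem of_map {α' : Type*} [MeasurableSpace α'] {T : α → α'} (hT : Measurable T) {φ : α' → F}
    {c : ℝ} (h : L2Le (β.map T) φ c) : L2Le β (fun a => φ (T a)) c := by
  refine ⟨h.memLp.comp_of_map hT.aemeasurable, ?_⟩
  exact (integral_map hT.aemeasurable (h.memLp.1.norm.pow 2)).symm.trans_le h.le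

theorem add {φ ψ : α → F} {c c' : ℝ} (h : L2Le β φ c) (h' : L2Le β ψ c') :
    L2Le β (fun a => φ a + ψ a) (2 * c + 2 * c') := by
  refine ⟨h.memLp.add h'.memLp, ?_⟩
  calc ∫ a, ‖φ a + ψ a‖ ^ 2 ∂β ≤ ∫ a, (2 * ‖φ a‖ ^ 2 + 2 * ‖ψ a‖ ^ 2) ∂β := by
        refine integral_mono_of_nonneg (Filter.Eventually.of_forall fun _ => by positivity)
          ((h.integrable_sq.const_mul 2).add (h'.integrable_sq.const_mul 2))
          (Filter.Eventually.of_forall fun a => ?_)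
        have h1 := norm_add_le (φ a) (ψ a)
        have h2 : ‖φ a + ψ a‖ ^ 2 ≤ (‖φ a‖ + ‖ψ a‖) ^ 2 := by gcongr
        change ‖φ a + ψ a‖ ^ 2 ≤ 2 * ‖φ a‖ ^ 2 + 2 * ‖ψ a‖ ^ 2
        nlinarith [sq_nonneg (‖φ a‖ - ‖ψ a‖)]
    _ = 2 * ∫ a, ‖φ a‖ ^ 2 ∂β + 2 * ∫ a, ‖ψ a‖ ^ 2 ∂β := by
        rw [integral_add (h.integrable_sq.const_mul 2) (h'.integrable_sq.const_mul 2),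
          integral_const_mul, integral_const_mul]
    _ ≤ _ := by have := h.le; have := h'.le; linarith

theorem of_norm_le {F' : Type*} [NormedAddCommGroup F'] {φ : α → F} {ψ : α → F'} {M c : ℝ}
    (hφ : AEStronglyMeasurable φ β)
    (h : L2Le β ψ c) (hle : ∀ᵐ a ∂β, ‖φ a‖ ≤ M * ‖ψ a‖) : L2Le β φ (M ^ 2 * c) := by
  refine ⟨h.memLp.of_le_mul hφ hle, ?_⟩
  calc ∫ a, ‖φ a‖ ^ 2 ∂β ≤ ∫ a, M ^ 2 * ‖ψ a‖ ^ 2 ∂β := by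
        refine integral_mono_of_nonneg (Filter.Eventually.of_forall fun _ => by positivity)
          (h.integrable_sq.const_mul _) ?_
        filter_upwards [hle] with a ha
        rw [← mul_pow]
        gcongr
    _ = M ^ 2 * ∫ a, ‖ψ a‖ ^ 2 ∂β := integral_const_mul _ _
    _ ≤ _ := by have := h.le; gcongr

theorem of_bound [IsProbabilityMeasure β] {φ : α → F} {M : ℝ} (hφ : AEStronglyMeasurable φ β)
    (hle : ∀ᵐ a ∂β, ‖φ a‖ ≤ M) : L2Le β φ (M ^ 2) := by
  have h1 : L2Le β (fun _ : α => (1 : ℝ)) 1 := ⟨memLp_const 1, by simp⟩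
  simpa using of_norm_le (M := M) hφ h1 (by simpa using hle)

/-- By Cauchy–Schwarz, without any independence of the summands. This is the source of the factor
`m²` in `L̃²`. -/
theorem finset_sum {ι : Type*} [Fintype ι] {φ : ι → α → F} {c : ℝ} (h : ∀ i, L2Le β (φ i) c) :
    L2Le β (fun a => ∑ i, φ i a) ((Fintype.card ι : ℝ) ^ 2 * c) := by
  refine ⟨memLp_finsetSum _ fun i _ => (h i).memLp, ?_⟩
  calc ∫ a, ‖∑ i, φ i a‖ ^ 2 ∂β ≤ ∫ a, (Fintype.card ι : ℝ) * ∑ i, ‖φ i a‖ ^ 2 ∂β := by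
        refine integral_mono_of_nonneg (Filter.Eventually.of_forall fun _ => by positivity)
          ((integrable_finsetSum _ fun i _ => (h i).integrable_sq).const_mul _)
          (Filter.Eventually.of_forall fun a => ?_)
        have h1 : ‖∑ i, φ i a‖ ^ 2 ≤ (∑ i, ‖φ i a‖) ^ 2 := by gcongr; exact norm_sum_le _ _
        exact h1.trans (sq_sum_le_card_mul_sum_sq)
    _ = Fintype.card ι * ∑ i, ∫ a, ‖φ i a‖ ^ 2 ∂β := by
        rw [integral_const_mul, integral_finsetSum _ fun i _ => (h i).integrable_sq]
    _ ≤ Fintype.card ι * ∑ _i : ι, c := by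
        gcongr with i
        exact (h i).le
    _ = _ := by simp; ring

theorem const_smul [NormedSpace ℝ F] {φ : α → F} {c : ℝ} (h : L2Le β φ c) (r : ℝ) :
    L2Le β (fun a => r • φ a) (r ^ 2 * c) := by
  have := of_norm_le (M := |r|) (φ := fun a => r • φ a) (h.memLp.1.const_smul r) h
    (Filter.Eventually.of_forall fun a => by simp [norm_smul])
  rwa [sq_abs] at this

theorem integrable [IsProbabilityMeasure β] {φ : α → F} {c : ℝ} (h : L2Le β φ c) :
    Integrable φ β :=
  h.memLp.integrable one_le_two

/-- Young's inequality is used in place of Cauchy–Schwarz because the result is linear in `c`, so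
that it can be averaged over the iterations. -/
theorem integral_norm_le [IsProbabilityMeasure β] {φ : α → F} {c : ℝ} (h : L2Le β φ c) {ε : ℝ} (hε : 0 < ε) :
    ∫ a, ‖φ a‖ ∂β ≤ (c / ε + ε) / 2 := by
  have hi : Integrable (fun a => (‖φ a‖ ^ 2 / ε + ε) / 2) β :=
    ((h.integrable_sq.div_const ε).add (integrable_const ε)).div_const 2
  calc ∫ a, ‖φ a‖ ∂β ≤ ∫ a, (‖φ a‖ ^ 2 / ε + ε) / 2 ∂β := by
        refine integral_mono (h.memLp.integrable one_le_two).norm hi fun a => ?_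
        change ‖φ a‖ ≤ (‖φ a‖ ^ 2 / ε + ε) / 2
        rw [div_add' _ _ _ hε.ne', div_div, le_div_iff₀ (by positivity)]
        nlinarith [sq_nonneg (‖φ a‖ - ε)]
    _ = ((∫ a, ‖φ a‖ ^ 2 ∂β) / ε + ε) / 2 := by
        rw [integral_div, integral_add (h.integrable_sq.div_const ε) (integrable_const ε),
          integral_div]
        simp
    _ ≤ _ := by have := h.le; gcongr

end L2Le

end L2

section Inner

variable {α F : Type*} [MeasurableSpace α] [NormedAddCommGroup F] [InnerProductSpace ℝ F]
  [CompleteSpace F] {β : Measure α} [IsProbabilityMeasure β]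

namespace L2Le

theorem integral_norm_const_add_sq {φ : α → F} {c : ℝ} (h : L2Le β φ c) (v : F) :
    ∫ a, ‖v + φ a‖ ^ 2 ∂β = ‖v‖ ^ 2 + 2 * inner ℝ v (∫ a, φ a ∂β) + ∫ a, ‖φ a‖ ^ 2 ∂β := by
  have h1 : ∀ a, ‖v + φ a‖ ^ 2 = (‖v‖ ^ 2 + 2 * inner ℝ v (φ a)) + ‖φ a‖ ^ 2 := fun a =>
    norm_add_sq_real v (φ a)
  have h2 : Integrable (fun a => 2 * inner ℝ v (φ a)) β :=
    (h.integrable.const_inner v).const_mul 2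
  simp_rw [h1]
  have h3 : Integrable (fun a => ‖v‖ ^ 2 + 2 * inner ℝ v (φ a)) β := (integrable_const _).add h2
  rw [integral_add h3 h.integrable_sq,
    integral_add (integrable_const _) h2, integral_const_mul, integral_inner h.integrable]
  simp

/-- Centred noise is orthogonal to constants; this keeps the contraction factor of the estimator
free of a factor `2`. -/
theorem const_add {φ : α → F} {c : ℝ} (h : L2Le β φ c) (h0 : ∫ a, φ a ∂β = 0) (v : F) :
    L2Le β (fun a => v + φ a) (‖v‖ ^ 2 + c) := by
  refine ⟨(memLp_const v).add h.memLp, ?_⟩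
  rw [h.integral_norm_const_add_sq, h0, inner_zero_right]
  have := h.le
  linarith

/-- Variance is at most the second moment. -/
theorem sub_mean {φ : α → F} {c : ℝ} (h : L2Le β φ c) {v : F} (hv : ∫ a, φ a ∂β = v) :
    L2Le β (fun a => φ a - v) c := by
  refine ⟨h.memLp.sub (memLp_const v), ?_⟩
  have h1 := h.integral_norm_const_add_sq (-v)
  rw [hv, inner_neg_left, real_inner_self_eq_norm_sq, norm_neg] at h1
  have h2 : ∀ a, φ a - v = -v + φ a := fun a => by abel
  simp_rw [h2, h1]
  have := h.le
  nlinarith [sq_nonneg ‖v‖]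

end L2Le

/-- Conditioning on an independent variable: a bound for the partial second moments of `ψ (u, ·)`
at the values of `U` integrates to a bound for the second moment of `ψ (U, V)`. -/
theorem L2Le.of_indep {Ω S T G : Type*} [MeasurableSpace Ω] [MeasurableSpace S]
    [MeasurableSpace T] [NormedAddCommGroup G] {μ : Measure Ω} [IsProbabilityMeasure μ]
    {U : Ω → S} {V : Ω → T} (hU : Measurable U) (hV : Measurable V) (hUV : IndepFun U V μ)
    {ψ : S × T → G} (hψ : StronglyMeasurable ψ) {b : Ω → ℝ} (hb : Integrable b μ)
    (hin : ∀ ω, L2Le (μ.map V) (fun t => ψ (U ω, t)) (b ω)) :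
    L2Le μ (fun ω => ψ (U ω, V ω)) (∫ ω, b ω ∂μ) := by
  have := Measure.isProbabilityMeasure_map (μ := μ) hV.aemeasurable
  have := Measure.isProbabilityMeasure_map (μ := μ) hU.aemeasurable
  have hm : StronglyMeasurable fun ω => ψ (U ω, V ω) := hψ.comp_measurable (hU.prodMk hV)
  have hψm : Measurable fun p : S × T => ENNReal.ofReal (‖ψ p‖ ^ 2) :=
    (hψ.norm.measurable.pow_const 2).ennreal_ofReal
  have hb0 : ∀ ω, 0 ≤ b ω := fun ω => (hin ω).nonneg
  refine L2Le.of_lintegral hm.aestronglyMeasurable (integral_nonneg hb0) ?_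
  calc ∫⁻ ω, ENNReal.ofReal (‖ψ (U ω, V ω)‖ ^ 2) ∂μ
      = ∫⁻ p, ENNReal.ofReal (‖ψ p‖ ^ 2) ∂(μ.map fun ω => (U ω, V ω)) := by
        rw [lintegral_map hψm (hU.prodMk hV)]
    _ = ∫⁻ p, ENNReal.ofReal (‖ψ p‖ ^ 2) ∂((μ.map U).prod (μ.map V)) := by
        rw [(indepFun_iff_map_prod_eq_prod_map_map hU.aemeasurable hV.aemeasurable).1 hUV]
    _ = ∫⁻ u, ∫⁻ t, ENNReal.ofReal (‖ψ (u, t)‖ ^ 2) ∂(μ.map V) ∂(μ.map U) :=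
        lintegral_prod _ hψm.aemeasurable
    _ = ∫⁻ ω, ∫⁻ t, ENNReal.ofReal (‖ψ (U ω, t)‖ ^ 2) ∂(μ.map V) ∂μ :=
        lintegral_map hψm.lintegral_prod_right' hU
    _ ≤ ∫⁻ ω, ENNReal.ofReal (b ω) ∂μ := by
        refine lintegral_mono fun ω => ?_
        rw [← ofReal_integral_eq_lintegral_ofReal (hin ω).integrable_sq
          (Filter.Eventually.of_forall fun _ => by positivity)]
        exact ENNReal.ofReal_le_ofReal (hin ω).le
    _ = _ := (ofReal_integral_eq_lintegral_ofReal hb (Filter.Eventually.of_forall hb0)).symm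

end Inner

end StochPenalty

/-! ### Moments of the stochastic gradient for one sample -/

namespace StochPenalty

/-- Jensen's inequality, read off from the nonnegativity of the variance. -/
theorem L2Le.norm_integral_sq_le {α F : Type*} [MeasurableSpace α] [NormedAddCommGroup F]
    [InnerProductSpace ℝ F] [CompleteSpace F] {β : Measure α} [IsProbabilityMeasure β]
    {φ : α → F} {c : ℝ} (h : L2Le β φ c) : ‖∫ a, φ a ∂β‖ ^ 2 ≤ c := by
  have h1 := h.integral_norm_const_add_sq (-∫ a, φ a ∂β)
  rw [inner_neg_left, real_inner_self_eq_norm_sq, norm_neg] at h1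
  have h2 : 0 ≤ ∫ a, ‖-(∫ a, φ a ∂β) + φ a‖ ^ 2 ∂β := integral_nonneg fun _ => by positivity
  have := h.le
  linarith

namespace Problem

variable {d m : ℕ} {Ξ Z : Type*} [MeasurableSpace Ξ] [MeasurableSpace Z]

/-- Mean of the gradient oracle of the objective. -/
noncomputable def meanGradF (P : Problem d m Ξ Z) (x : Vec d) : Vec d :=
  ∫ ξ, P.gradF x ξ ∂P.lawXi

/-- Mean of the gradient oracle of the `i`-th constraint. -/
noncomputable def meanGradC (P : Problem d m Ξ Z) (i : Fin m) (x : Vec d) : Vec d :=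
  ∫ ζ, P.gradC i x ζ ∂P.lawZeta

/-- Mean of the gradient oracle of the penalty function. -/
noncomputable def meanGradQ (P : Problem d m Ξ Z) (r : ℝ) (x : Vec d) : Vec d :=
  P.meanGradF x + r • ∑ i, P.c x i • P.meanGradC i x

/-- The oracle `∑ᵢ c̃ᵢ(x, ζ²) ∇̃cᵢ(x, ζ¹)` for the gradient of `‖c‖² / 2`. -/
noncomputable def gradPen (P : Problem d m Ξ Z) (x : Vec d) (B : Ξ × Z × Z) : Vec d :=
  ∑ i, P.cT x B.2.2 i • P.gradC i x B.2.1

theorem gradQ_eq (P : Problem d m Ξ Z) (r : ℝ) (x : Vec d) (B : Ξ × Z × Z) :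
    P.gradQ r x B = P.gradF x B.1 + r • P.gradPen x B := rfl

/-- The law of a single sample `(ξ, ζ¹, ζ²)`. -/
structure IsSampleLaw (P : Problem d m Ξ Z) (β : Measure (Ξ × Z × Z)) : Prop where
  prob : IsProbabilityMeasure β
  xi : β.map (fun b => b.1) = P.lawXi
  zeta₁ : β.map (fun b => b.2.1) = P.lawZeta
  zeta₂ : β.map (fun b => b.2.2) = P.lawZeta
  pair : β.map (fun b => b.2) = P.lawZeta.prod P.lawZeta

/-- Almost sure bound for `gradPen`. -/
def penBound (κ : Constants) (m : ℕ) : ℝ := m * (κ.CTc * κ.CTgc)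

/-- Variance constant: the variance of `gradQ r` is at most `varConst * r²` for `r ≥ 1`. -/
def varConst (κ : Constants) (m : ℕ) : ℝ := 2 * κ.σf ^ 2 + 2 * penBound κ m ^ 2

variable {P : Problem d m Ξ Z} {κ : Constants} {β : Measure (Ξ × Z × Z)}

theorem Standing.c_apply (hS : P.Standing) (x : Vec d) (i : Fin m) :
    P.c x i = ∫ ζ, P.cT x ζ i ∂P.lawZeta :=
  ((EuclideanSpace.proj i : Vec m →L[ℝ] ℝ).integral_comp_comm (hS.integrable_cT x)).symm

theorem Standing.measurable_cT_apply (hS : P.Standing) (x : Vec d) (i : Fin m) :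
    Measurable fun ζ => P.cT x ζ i :=
  (EuclideanSpace.proj i : Vec m →L[ℝ] ℝ).continuous.measurable.comp
    (hS.measurable_cT.comp measurable_prodMk_left)

theorem Standing.measurable_gradC_apply (hS : P.Standing) (i : Fin m) (x : Vec d) :
    Measurable (P.gradC i x) :=
  (hS.measurable_gradC i).comp measurable_prodMk_left

theorem Standing.measurable_gradF_apply (hS : P.Standing) (x : Vec d) :
    Measurable (P.gradF x) :=
  hS.measurable_gradF.comp measurable_prodMk_left

theorem Standing.measurable_gradPen (hS : P.Standing) :
    Measurable (Function.uncurry P.gradPen) := by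
  change Measurable fun p : Vec d × Ξ × Z × Z =>
    ∑ i, P.cT p.1 p.2.2.2 i • P.gradC i p.1 p.2.2.1
  refine Finset.measurable_fun_sum _ fun i _ => Measurable.fun_smul ?_ ?_
  · exact (EuclideanSpace.proj i : Vec m →L[ℝ] ℝ).continuous.measurable.comp
      (hS.measurable_cT.comp (measurable_fst.prodMk (measurable_snd.comp
        (measurable_snd.comp measurable_snd))))
  · exact (hS.measurable_gradC i).comp (measurable_fst.prodMk (measurable_fst.comp
        (measurable_snd.comp measurable_snd)))

theorem Standing.measurable_gradQ (hS : P.Standing) (r : ℝ) :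
    Measurable (Function.uncurry (P.gradQ r)) :=
  (hS.measurable_gradF.comp (measurable_fst.prodMk (measurable_fst.comp measurable_snd))).add
    (hS.measurable_gradPen.const_smul r)

theorem Standing.measurable_gradPen_apply (hS : P.Standing) (x : Vec d) :
    Measurable (P.gradPen x) :=
  hS.measurable_gradPen.comp measurable_prodMk_left

theorem Standing.measurable_c (hS : P.Standing) : Measurable P.c := by
  have := hS.probZeta
  exact (hS.measurable_cT.stronglyMeasurable.integral_prod_right (ν := P.lawZeta)).measurable

theorem Standing.measurable_meanGradF (hS : P.Standing) : Measurable P.meanGradF := by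
  have := hS.probXi
  exact (hS.measurable_gradF.stronglyMeasurable.integral_prod_right (ν := P.lawXi)).measurable

theorem Standing.measurable_meanGradC (hS : P.Standing) (i : Fin m) :
    Measurable (P.meanGradC i) := by
  have := hS.probZeta
  exact ((hS.measurable_gradC i).stronglyMeasurable.integral_prod_right
    (ν := P.lawZeta)).measurable

/-- The oracle mean stands in for `∇Q`: it agrees with the gradient on `X`, and as a parametric
integral it is measurable on the whole space. -/
theorem Standing.measurable_meanGradQ (hS : P.Standing) (r : ℝ) : Measurable (P.meanGradQ r) := by
  refine hS.measurable_meanGradF.add (Measurable.const_smul ?_ r)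
  refine Finset.measurable_fun_sum _ fun i _ => Measurable.fun_smul ?_ (hS.measurable_meanGradC i)
  exact (EuclideanSpace.proj i : Vec m →L[ℝ] ℝ).continuous.measurable.comp hS.measurable_c

namespace IsSampleLaw

theorem ae_gradC (hβ : P.IsSampleLaw β) (hB : P.Bounds κ) {x : Vec d} (hx : x ∈ P.X) (i : Fin m) :
    ∀ᵐ b ∂β, ‖P.gradC i x b.2.1‖ ≤ κ.CTgc := by
  have h := hB.gradC x hx i
  rw [← hβ.zeta₁] at h
  exact ae_of_ae_map (measurable_fst.comp measurable_snd).aemeasurable h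

theorem ae_cT (hβ : P.IsSampleLaw β) (hB : P.Bounds κ) {x : Vec d} (hx : x ∈ P.X) (i : Fin m) :
    ∀ᵐ b ∂β, |P.cT x b.2.2 i| ≤ κ.CTc := by
  have h := hB.cT x hx i
  rw [← hβ.zeta₂] at h
  exact ae_of_ae_map (measurable_snd.comp measurable_snd).aemeasurable h

theorem l2Le_gradPen (hβ : P.IsSampleLaw β) (hS : P.Standing) (hB : P.Bounds κ) {x : Vec d}
    (hx : x ∈ P.X) : L2Le β (P.gradPen x) (penBound κ m ^ 2) := by
  have := hβ.prob
  refine L2Le.of_bound (hS.measurable_gradPen_apply x).aestronglyMeasurable ?_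
  have h1 : ∀ᵐ b ∂β, ∀ i, ‖P.gradC i x b.2.1‖ ≤ κ.CTgc :=
    ae_all_iff.2 fun i => hβ.ae_gradC hB hx i
  have h2 : ∀ᵐ b ∂β, ∀ i, |P.cT x b.2.2 i| ≤ κ.CTc := ae_all_iff.2 fun i => hβ.ae_cT hB hx i
  filter_upwards [h1, h2] with b hb1 hb2
  calc ‖P.gradPen x b‖ ≤ ∑ i, ‖P.cT x b.2.2 i • P.gradC i x b.2.1‖ := norm_sum_le _ _
    _ ≤ ∑ _i : Fin m, κ.CTc * κ.CTgc := by
        refine Finset.sum_le_sum fun i _ => ?_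
        rw [norm_smul, Real.norm_eq_abs]
        exact mul_le_mul (hb2 i) (hb1 i) (norm_nonneg _) ((abs_nonneg _).trans (hb2 i))
    _ = penBound κ m := by simp [penBound]

/-- This is why two samples of `ζ` are drawn: their independence lets the mean of the product
factor. The swap only puts the scalar factor in the first coordinate. -/
theorem integral_gradPen (hβ : P.IsSampleLaw β) (hS : P.Standing) (hB : P.Bounds κ) {x : Vec d}
    (hx : x ∈ P.X) : ∫ b, P.gradPen x b ∂β = ∑ i, P.c x i • P.meanGradC i x := by
  have := hβ.prob
  have := hS.probZeta
  have hmeas : ∀ i, Measurable fun b : Ξ × Z × Z => P.cT x b.2.2 i • P.gradC i x b.2.1 := fun i =>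
    ((hS.measurable_cT_apply x i).comp (measurable_snd.comp measurable_snd)).smul
      ((hS.measurable_gradC_apply i x).comp (measurable_fst.comp measurable_snd))
  unfold gradPen
  rw [integral_finsetSum]
  · refine Finset.sum_congr rfl fun i _ => ?_
    have hm : Measurable fun z : Z × Z => P.cT x z.2 i • P.gradC i x z.1 :=
      ((hS.measurable_cT_apply x i).comp measurable_snd).smul
        ((hS.measurable_gradC_apply i x).comp measurable_fst)
    calc ∫ b, P.cT x b.2.2 i • P.gradC i x b.2.1 ∂β
        = ∫ z, P.cT x z.2 i • P.gradC i x z.1 ∂(β.map fun b => b.2) :=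
          (integral_map measurable_snd.aemeasurable hm.aestronglyMeasurable).symm
      _ = ∫ z, P.cT x z.2 i • P.gradC i x z.1 ∂(P.lawZeta.prod P.lawZeta) := by rw [hβ.pair]
      _ = ∫ z, P.cT x z.1 i • P.gradC i x z.2 ∂(P.lawZeta.prod P.lawZeta) :=
          (integral_prod_swap (μ := P.lawZeta) (ν := P.lawZeta)
            (fun z : Z × Z => P.cT x z.1 i • P.gradC i x z.2))
      _ = _ := by
          rw [integral_prod_smul (fun z => P.cT x z i) (P.gradC i x), ← hS.c_apply]
          rfl
  · intro i _
    refine Integrable.of_bound (hmeas i).aestronglyMeasurable (κ.CTc * κ.CTgc) ?_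
    filter_upwards [hβ.ae_gradC hB hx i, hβ.ae_cT hB hx i] with b hb1 hb2
    rw [norm_smul, Real.norm_eq_abs]
    exact mul_le_mul hb2 hb1 (norm_nonneg _) ((abs_nonneg _).trans hb2)

theorem integrable_gradF (hβ : P.IsSampleLaw β) (hS : P.Standing) {x : Vec d} (hx : x ∈ P.X) :
    Integrable (fun b : Ξ × Z × Z => P.gradF x b.1) β := by
  have h := hS.integrable_gradF x hx
  rw [← hβ.xi] at h
  exact h.comp_measurable measurable_fst

theorem integral_gradF (hβ : P.IsSampleLaw β) (hS : P.Standing) (x : Vec d) :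
    ∫ b, P.gradF x b.1 ∂β = P.meanGradF x := by
  unfold meanGradF
  rw [← hβ.xi, integral_map measurable_fst.aemeasurable
    (hS.measurable_gradF_apply x).aestronglyMeasurable]

theorem integrable_gradQ (hβ : P.IsSampleLaw β) (hS : P.Standing) (hB : P.Bounds κ) (r : ℝ)
    {x : Vec d} (hx : x ∈ P.X) : Integrable (P.gradQ r x) β := by
  have := hβ.prob
  exact (hβ.integrable_gradF hS hx).add ((hβ.l2Le_gradPen hS hB hx).integrable.smul r)

theorem integral_gradQ (hβ : P.IsSampleLaw β) (hS : P.Standing) (hB : P.Bounds κ) (r : ℝ)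
    {x : Vec d} (hx : x ∈ P.X) : ∫ b, P.gradQ r x b ∂β = P.meanGradQ r x := by
  have := hβ.prob
  simp_rw [gradQ_eq]
  rw [integral_add (hβ.integrable_gradF hS hx)
    ((hβ.l2Le_gradPen hS hB hx).const_smul r).integrable, integral_smul, hβ.integral_gradF hS,
    hβ.integral_gradPen hS hB hx]
  rfl

theorem l2Le_gradF_sub (hβ : P.IsSampleLaw β) (hS : P.Standing) (hM : P.MeanSquareSmooth κ)
    {x y : Vec d} (hx : x ∈ P.X) (hy : y ∈ P.X) :
    L2Le β (fun b => P.gradF x b.1 - P.gradF y b.1) (κ.Lgf ^ 2 * ‖x - y‖ ^ 2) := by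
  refine L2Le.of_map (T := fun b : Ξ × Z × Z => b.1) (φ := fun ξ => P.gradF x ξ - P.gradF y ξ)
    measurable_fst ?_
  rw [hβ.xi]
  exact L2Le.of_lintegral ((hS.measurable_gradF_apply x).sub
    (hS.measurable_gradF_apply y)).aestronglyMeasurable (by positivity) (hM.gradF x hx y hy)

/-- Product rule: vary the gradient factor at a bounded value of `c̃ᵢ(x)`, then the value factor at
a bounded gradient `∇̃cᵢ(y)`. The almost sure bounds are what allow the products to be square
integrable without higher moments. -/
theorem l2Le_gradPen_sub (hβ : P.IsSampleLaw β) (hS : P.Standing) (hM : P.MeanSquareSmooth κ)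
    (hB : P.Bounds κ) {x y : Vec d} (hx : x ∈ P.X) (hy : y ∈ P.X) :
    L2Le β (fun b => P.gradPen x b - P.gradPen y b)
      ((m : ℝ) ^ 2 * (2 * (κ.CTc ^ 2 * (κ.Lgc ^ 2 * ‖x - y‖ ^ 2))
        + 2 * (κ.CTgc ^ 2 * (κ.Lc ^ 2 * ‖x - y‖ ^ 2)))) := by
  have hG : ∀ i, L2Le β (fun b => P.gradC i x b.2.1 - P.gradC i y b.2.1)
      (κ.Lgc ^ 2 * ‖x - y‖ ^ 2) := fun i => by
    refine L2Le.of_map (T := fun b : Ξ × Z × Z => b.2.1)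
      (φ := fun ζ => P.gradC i x ζ - P.gradC i y ζ) (measurable_fst.comp measurable_snd) ?_
    rw [hβ.zeta₁]
    exact L2Le.of_lintegral ((hS.measurable_gradC_apply i x).sub
      (hS.measurable_gradC_apply i y)).aestronglyMeasurable (by positivity) (hM.gradC x hx y hy i)
  have hC : ∀ i, L2Le β (fun b => P.cT x b.2.2 i - P.cT y b.2.2 i)
      (κ.Lc ^ 2 * ‖x - y‖ ^ 2) := fun i => by
    refine L2Le.of_map (T := fun b : Ξ × Z × Z => b.2.2)
      (φ := fun ζ => P.cT x ζ i - P.cT y ζ i) (measurable_snd.comp measurable_snd) ?_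
    rw [hβ.zeta₂]
    exact L2Le.of_lintegral ((hS.measurable_cT_apply x i).sub
      (hS.measurable_cT_apply y i)).aestronglyMeasurable (by positivity) (hM.cT x hx y hy i)
  have hterm : ∀ i, L2Le β (fun b => P.cT x b.2.2 i • (P.gradC i x b.2.1 - P.gradC i y b.2.1)
      + (P.cT x b.2.2 i - P.cT y b.2.2 i) • P.gradC i y b.2.1)
      (2 * (κ.CTc ^ 2 * (κ.Lgc ^ 2 * ‖x - y‖ ^ 2))
        + 2 * (κ.CTgc ^ 2 * (κ.Lc ^ 2 * ‖x - y‖ ^ 2))) := fun i => by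
    refine L2Le.add (L2Le.of_norm_le ?_ (hG i) ?_) (L2Le.of_norm_le ?_ (hC i) ?_)
    · exact (((hS.measurable_cT_apply x i).comp
        (measurable_snd.comp measurable_snd)).aestronglyMeasurable).smul (hG i).memLp.1
    · filter_upwards [hβ.ae_cT hB hx i] with b hb
      rw [norm_smul, Real.norm_eq_abs]
      gcongr
    · exact (hC i).memLp.1.smul ((hS.measurable_gradC_apply i y).comp
        (measurable_fst.comp measurable_snd)).aestronglyMeasurable
    · filter_upwards [hβ.ae_gradC hB hy i] with b hb
      rw [norm_smul, mul_comm]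
      gcongr
  have hsum := L2Le.finset_sum hterm
  rw [Fintype.card_fin] at hsum
  convert hsum using 2 with b
  unfold gradPen
  rw [← Finset.sum_sub_distrib]
  refine Finset.sum_congr rfl fun i _ => ?_
  rw [smul_sub, sub_smul]
  abel

end IsSampleLaw

theorem Lt_sq (κ : Constants) (m : ℕ) : κ.Lt m ^ 2 = 4 * κ.Lgf ^ 2
    + 4 * (m : ℝ) ^ 2 * (κ.CTc ^ 2 * κ.Lgc ^ 2 + κ.CTgc ^ 2 * κ.Lc ^ 2) :=
  Real.sq_sqrt (by positivity)

namespace IsSampleLaw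

theorem l2Le_gradQ_sub (hβ : P.IsSampleLaw β) (hS : P.Standing) (hM : P.MeanSquareSmooth κ)
    (hB : P.Bounds κ) {r : ℝ} (hr : 1 ≤ r) {x y : Vec d} (hx : x ∈ P.X) (hy : y ∈ P.X) :
    L2Le β (fun b => P.gradQ r x b - P.gradQ r y b) (r ^ 2 * κ.Lt m ^ 2 * ‖x - y‖ ^ 2) := by
  have h := (hβ.l2Le_gradF_sub hS hM hx hy).add ((hβ.l2Le_gradPen_sub hS hM hB hx hy).const_smul r)
  have heq : (fun b => P.gradQ r x b - P.gradQ r y b) = fun b =>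
      P.gradF x b.1 - P.gradF y b.1 + r • (P.gradPen x b - P.gradPen y b) := by
    funext b
    rw [gradQ_eq, gradQ_eq, smul_sub]
    abel
  rw [heq]
  refine h.mono ?_
  rw [Lt_sq]
  have hr2 : 1 ≤ r ^ 2 := one_le_pow₀ hr
  have h1 : κ.Lgf ^ 2 * ‖x - y‖ ^ 2 ≤ r ^ 2 * (κ.Lgf ^ 2 * ‖x - y‖ ^ 2) :=
    le_mul_of_one_le_left (by positivity) hr2
  have h2 : 0 ≤ r ^ 2 * (κ.Lgf ^ 2 * ‖x - y‖ ^ 2) := by positivity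
  nlinarith

/-- `ξ` need not be independent of the `ζ` samples, so the two parts are added with the factor `2`.
The variance of the penalty part is bounded through its second moment. -/
theorem l2Le_gradQ_sub_mean (hβ : P.IsSampleLaw β) (hS : P.Standing) (hV : P.VarianceBounds κ)
    (hB : P.Bounds κ) {r : ℝ} (hr : 1 ≤ r) {x : Vec d} (hx : x ∈ P.X) :
    L2Le β (fun b => P.gradQ r x b - P.meanGradQ r x) (varConst κ m * r ^ 2) := by
  have := hβ.prob
  have hF : L2Le β (fun b => P.gradF x b.1 - P.meanGradF x) (κ.σf ^ 2) := by
    refine L2Le.of_map (T := fun b : Ξ × Z × Z => b.1) (φ := fun ξ => P.gradF x ξ - P.meanGradF x)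
      measurable_fst ?_
    rw [hβ.xi]
    refine L2Le.of_lintegral ((hS.measurable_gradF_apply x).sub_const _).aestronglyMeasurable
      (by positivity) ?_
    rw [meanGradF, hS.unbiased_gradF x hx]
    exact hV.gradF x hx
  have h := hF.add (((hβ.l2Le_gradPen hS hB hx).sub_mean
    (hβ.integral_gradPen hS hB hx)).const_smul r)
  have heq : (fun b => P.gradQ r x b - P.meanGradQ r x) = fun b =>
      P.gradF x b.1 - P.meanGradF x
        + r • (P.gradPen x b - ∑ i, P.c x i • P.meanGradC i x) := by
    funext b
    rw [gradQ_eq, meanGradQ, smul_sub]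
    abel
  rw [heq]
  refine h.mono ?_
  have hr2 : 1 ≤ r ^ 2 := one_le_pow₀ hr
  have h1 : κ.σf ^ 2 ≤ r ^ 2 * κ.σf ^ 2 := le_mul_of_one_le_left (by positivity) hr2
  unfold varConst
  nlinarith

/-- Mean-square smoothness of the oracle passes to its mean by Jensen, which makes `∇Q_r` Lipschitz
on `X`. -/
theorem norm_meanGradQ_sub_le (hβ : P.IsSampleLaw β) (hS : P.Standing) (hM : P.MeanSquareSmooth κ)
    (hB : P.Bounds κ) {r : ℝ} (hr : 1 ≤ r) {x y : Vec d} (hx : x ∈ P.X) (hy : y ∈ P.X) :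
    ‖P.meanGradQ r x - P.meanGradQ r y‖ ≤ r * κ.Lt m * ‖x - y‖ := by
  have := hβ.prob
  have h := (hβ.l2Le_gradQ_sub hS hM hB hr hx hy).norm_integral_sq_le
  rw [integral_sub (hβ.integrable_gradQ hS hB r hx) (hβ.integrable_gradQ hS hB r hy),
    hβ.integral_gradQ hS hB r hx, hβ.integral_gradQ hS hB r hy, ← mul_pow, ← mul_pow] at h
  have : 0 ≤ κ.Lt m := Real.sqrt_nonneg _
  exact le_of_sq_le_sq h (by positivity)

/-- One step of the recursive momentum estimator, conditionally on the past. -/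
theorem l2Le_estimator (hβ : P.IsSampleLaw β) (hS : P.Standing) (hM : P.MeanSquareSmooth κ)
    (hV : P.VarianceBounds κ) (hB : P.Bounds κ) {r r' α : ℝ} (hr : 1 ≤ r) (hr' : 1 ≤ r')
    (hα : 0 ≤ α) (hα1 : α ≤ 1) {y z : Vec d} (hy : y ∈ P.X) (hz : z ∈ P.X) (g : Vec d) :
    L2Le β (fun b => P.gradQ r' z b + (1 - α) • (g - P.gradQ r y b) - P.meanGradQ r' z)
      ((1 - α) ^ 2 * ‖g - P.meanGradQ r y‖ ^ 2 + (2 * α ^ 2 * (varConst κ m * r' ^ 2)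
        + 4 * (r ^ 2 * κ.Lt m ^ 2) * ‖z - y‖ ^ 2 + 4 * (r' - r) ^ 2 * penBound κ m ^ 2)) := by
  have := hβ.prob
  -- Change the point at fixed penalty `r`, then the penalty at the fixed point `z`; the second
  -- change is `(r' - r)` times the bounded oracle `gradPen`.
  have hdiff : L2Le β (fun b => P.gradQ r' z b - P.gradQ r y b)
      (2 * (r ^ 2 * κ.Lt m ^ 2 * ‖z - y‖ ^ 2) + 2 * ((r' - r) ^ 2 * penBound κ m ^ 2)) := by
    convert (hβ.l2Le_gradQ_sub hS hM hB hr hz hy).add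
      ((hβ.l2Le_gradPen hS hB hz).const_smul (r' - r)) using 2 with b
    simp only [gradQ_eq, sub_smul]
    abel
  have hmean : ∫ b, (P.gradQ r' z b - P.gradQ r y b) ∂β = P.meanGradQ r' z - P.meanGradQ r y := by
    rw [integral_sub (hβ.integrable_gradQ hS hB r' hz) (hβ.integrable_gradQ hS hB r hy),
      hβ.integral_gradQ hS hB r' hz, hβ.integral_gradQ hS hB r hy]
  have hA := (hβ.l2Le_gradQ_sub_mean hS hV hB hr' hz).const_smul α
  have hD := (hdiff.sub_mean hmean).const_smul (1 - α)
  have hN := hA.add hD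
  -- The same sample is used at both points, so the noise is `α` times one oracle error plus `1 - α`
  -- times a centred oracle difference. The first is small through `α`, the second through the step
  -- length and the change of penalty.
  have hzero : ∫ b, (α • (P.gradQ r' z b - P.meanGradQ r' z) + (1 - α) •
      (P.gradQ r' z b - P.gradQ r y b - (P.meanGradQ r' z - P.meanGradQ r y))) ∂β = 0 := by
    rw [integral_add hA.integrable hD.integrable, integral_smul, integral_smul,
      integral_sub (hβ.integrable_gradQ hS hB r' hz) (integrable_const _),
      integral_sub hdiff.integrable (integrable_const _), hmean, hβ.integral_gradQ hS hB r' hz]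
    simp
  have h := hN.const_add hzero ((1 - α) • (g - P.meanGradQ r y))
  rw [norm_smul, mul_pow, Real.norm_eq_abs, sq_abs] at h
  have heq : (fun b => P.gradQ r' z b + (1 - α) • (g - P.gradQ r y b) - P.meanGradQ r' z) =
      fun b => (1 - α) • (g - P.meanGradQ r y) + (α • (P.gradQ r' z b - P.meanGradQ r' z)
        + (1 - α) • (P.gradQ r' z b - P.gradQ r y b - (P.meanGradQ r' z - P.meanGradQ r y))) := by
    funext b
    module
  rw [heq]
  refine h.mono ?_
  have h1 : (1 - α) ^ 2 ≤ 1 := by nlinarith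
  have h2 := mul_le_mul_of_nonneg_right h1 hdiff.nonneg
  linarith

end IsSampleLaw

end Problem

end StochPenalty

/-! ### Projections and normal cones -/

namespace StochPenalty

section Geometry

variable {d : ℕ} {X : Set (Vec d)}

theorem IsProj.inner_le_zero (hX : Convex ℝ X) {v p : Vec d} (hp : IsProj X v p) :
    ∀ y ∈ X, inner ℝ (v - p) (y - p) ≤ 0 := by
  refine (norm_eq_iInf_iff_real_inner_le_zero hX hp.1).1 ?_
  have : Nonempty X := ⟨⟨p, hp.1⟩⟩
  refine le_antisymm (le_ciInf fun y => hp.2 y y.2) ?_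
  exact ciInf_le (f := fun y : X => ‖v - y‖) ⟨0, by rintro _ ⟨y, rfl⟩; exact norm_nonneg _⟩
    ⟨p, hp.1⟩

theorem IsProj.norm_sub_le (hX : Convex ℝ X) {v v' p p' : Vec d} (hp : IsProj X v p)
    (hp' : IsProj X v' p') : ‖p - p'‖ ≤ ‖v - v'‖ := by
  have h1 := hp.inner_le_zero hX p' hp'.1
  have h2 := hp'.inner_le_zero hX p hp.1
  have h3 : ‖p - p'‖ ^ 2 ≤ inner ℝ (v - v') (p - p') := by
    rw [← real_inner_self_eq_norm_sq]
    have : inner ℝ (v - v') (p - p') - inner ℝ (p - p') (p - p')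
        = -(inner ℝ (v - p) (p' - p) + inner ℝ (v' - p') (p - p')) := by
      simp only [inner_sub_left, inner_sub_right]
      ring
    linarith
  have h4 := real_inner_le_norm (v - v') (p - p')
  by_contra! hlt
  have : 0 < ‖p - p'‖ := (norm_nonneg _).trans_lt hlt
  nlinarith

theorem exists_isProj (hX : IsClosed X) (hne : X.Nonempty) (v : Vec d) : ∃ p, IsProj X v p := by
  obtain ⟨p, hp, h⟩ := hX.exists_infDist_eq_dist hne v
  refine ⟨p, hp, fun y hy => ?_⟩
  rw [← dist_eq_norm, ← dist_eq_norm, ← h]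
  exact Metric.infDist_le_dist_of_mem hy

/-- Projection onto a closed convex set preserves measurability. -/
theorem measurable_of_isProj {Ω : Type*} [MeasurableSpace Ω] (hX : IsClosed X)
    (hc : Convex ℝ X) (hne : X.Nonempty) {v p : Ω → Vec d} (hv : Measurable v)
    (hp : ∀ ω, IsProj X (v ω) (p ω)) : Measurable p := by
  choose π hπ using exists_isProj hX hne
  have hcont : LipschitzWith 1 π := LipschitzWith.of_dist_le_mul fun a b => by
    simpa [dist_eq_norm] using (hπ a).norm_sub_le hc (hπ b)
  have heq : p = fun ω => π (v ω) := by
    funext ω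
    have := (hp ω).norm_sub_le hc (hπ (v ω))
    rw [sub_self, norm_zero] at this
    exact sub_eq_zero.1 (norm_le_zero_iff.1 this)
  rw [heq]
  exact hcont.continuous.measurable.comp hv

theorem zero_mem_negNormal (X : Set (Vec d)) (x : Vec d) :
    (0 : Vec d) ∈ {w | -w ∈ normalCone X x} := by
  intro y _
  simp

theorem isClosed_negNormal (X : Set (Vec d)) (x : Vec d) :
    IsClosed {w | -w ∈ normalCone X x} := by
  have : {w | -w ∈ normalCone X x} = ⋂ y ∈ X, {w | inner ℝ (-w) (y - x) ≤ 0} := by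
    ext w; simp [normalCone]
  rw [this]
  refine isClosed_biInter fun y _ => isClosed_le ?_ continuous_const
  fun_prop

theorem exists_distNegNormal_eq (X : Set (Vec d)) (x v : Vec d) :
    ∃ w, -w ∈ normalCone X x ∧ distNegNormal X x v = ‖v - w‖ := by
  obtain ⟨w, hw, h⟩ := (isClosed_negNormal X x).exists_infDist_eq_dist
    ⟨0, zero_mem_negNormal X x⟩ v
  exact ⟨w, hw, by rw [← dist_eq_norm]; exact h⟩

theorem distNegNormal_le {x v w : Vec d} (hw : -w ∈ normalCone X x) :
    distNegNormal X x v ≤ ‖v - w‖ := by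
  rw [← dist_eq_norm]
  exact Metric.infDist_le_dist_of_mem hw

theorem distNegNormal_nonneg (X : Set (Vec d)) (x v : Vec d) : 0 ≤ distNegNormal X x v :=
  Metric.infDist_nonneg

theorem distNegNormal_le_add (X : Set (Vec d)) (x u v : Vec d) :
    distNegNormal X x u ≤ distNegNormal X x v + ‖u - v‖ := by
  rw [← dist_eq_norm]
  exact Metric.infDist_le_infDist_add_dist

/-- The normal cone is invariant under positive scaling, so the distance to its negative is
positively homogeneous. -/
theorem mul_distNegNormal_le (X : Set (Vec d)) (x v : Vec d) {r : ℝ} (hr : 0 < r) :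
    r * distNegNormal X x v ≤ distNegNormal X x (r • v) := by
  obtain ⟨w, hw, h⟩ := exists_distNegNormal_eq X x (r • v)
  have hw' : -(r⁻¹ • w) ∈ normalCone X x := by
    intro y hy
    rw [← smul_neg, inner_smul_left]
    exact mul_nonpos_of_nonneg_of_nonpos (by simp; positivity) (hw y hy)
  have h1 := distNegNormal_le (v := v) hw'
  rw [h]
  calc r * distNegNormal X x v ≤ r * ‖v - r⁻¹ • w‖ := by gcongr
    _ = ‖r • (v - r⁻¹ • w)‖ := by rw [norm_smul, Real.norm_of_nonneg hr.le]
    _ = ‖r • v - w‖ := by rw [smul_sub, smul_inv_smul₀ hr.ne']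

/-- The normal cone has closed graph: nearest points along a convergent sequence stay bounded, and
any cluster point is again normal. Lower semicontinuity is all that the measurability of the
residual requires. -/
theorem isClosed_distNegNormal_le (X : Set (Vec d)) (s : ℝ) :
    IsClosed {p : Vec d × Vec d | distNegNormal X p.1 p.2 ≤ s} := by
  refine IsSeqClosed.isClosed fun u p hu hup => ?_
  have hu1 : Filter.Tendsto (fun n => (u n).1) Filter.atTop (nhds p.1) :=
    (continuous_fst.tendsto p).comp hup
  have hu2 : Filter.Tendsto (fun n => (u n).2) Filter.atTop (nhds p.2) :=
    (continuous_snd.tendsto p).comp hup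
  choose w hw hdist using fun n => exists_distNegNormal_eq X (u n).1 (u n).2
  have hws : ∀ n, ‖(u n).2 - w n‖ ≤ s := fun n => (hdist n).symm.trans_le (hu n)
  obtain ⟨R, hR⟩ := (Metric.isBounded_range_of_tendsto _ hu2).exists_norm_le
  have hwb : ∀ n, w n ∈ Metric.closedBall (0 : Vec d) (R + s) := fun n => by
    rw [mem_closedBall_zero_iff]
    have h1 := hR (u n).2 ⟨n, rfl⟩
    have h2 := norm_sub_norm_le (w n) (u n).2
    rw [norm_sub_rev] at h2
    linarith [hws n]
  obtain ⟨w', -, φ, hφ, hlim⟩ := tendsto_subseq_of_bounded Metric.isBounded_closedBall hwb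
  have hmem : -w' ∈ normalCone X p.1 := by
    intro y hy
    have h1 : Filter.Tendsto (fun n => inner ℝ (-(w (φ n))) (y - (u (φ n)).1)) Filter.atTop
        (nhds (inner ℝ (-w') (y - p.1))) :=
      Filter.Tendsto.inner hlim.neg (tendsto_const_nhds.sub (hu1.comp hφ.tendsto_atTop))
    exact le_of_tendsto h1 (Filter.Eventually.of_forall fun n => hw (φ n) y hy)
  have hle : ‖p.2 - w'‖ ≤ s := by
    have h1 : Filter.Tendsto (fun n => ‖(u (φ n)).2 - w (φ n)‖) Filter.atTop
        (nhds ‖p.2 - w'‖) := ((hu2.comp hφ.tendsto_atTop).sub hlim).norm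
    exact le_of_tendsto h1 (Filter.Eventually.of_forall fun n => hws (φ n))
  exact (distNegNormal_le hmem).trans hle

theorem measurable_distNegNormal (X : Set (Vec d)) :
    Measurable fun p : Vec d × Vec d => distNegNormal X p.1 p.2 :=
  measurable_of_Iic fun s => (isClosed_distNegNormal_le X s).measurableSet

/-- Stationarity of a projected step: `(x - η g - p) / η` is a normal vector at `p`. -/
theorem IsProj.distNegNormal_le (hX : Convex ℝ X) {x g p v : Vec d} {η : ℝ} (hη : 0 < η)
    (hp : IsProj X (x - η • g) p) :
    distNegNormal X p v ≤ ‖v - g‖ + η⁻¹ * ‖p - x‖ := by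
  have hw : -(g + η⁻¹ • (p - x)) ∈ normalCone X p := by
    intro y hy
    have h1 : -(g + η⁻¹ • (p - x)) = η⁻¹ • (x - η • g - p) := by
      rw [smul_sub, smul_sub, smul_sub, inv_smul_smul₀ hη.ne']
      abel
    rw [h1, inner_smul_left]
    exact mul_nonpos_of_nonneg_of_nonpos (by simp; positivity) (hp.inner_le_zero hX y hy)
  refine (StochPenalty.distNegNormal_le hw).trans ?_
  rw [← sub_sub]
  refine (_root_.norm_sub_le _ _).trans ?_
  rw [norm_smul, Real.norm_of_nonneg (by positivity)]

/-- The variational inequality of the projection, tested at the current point `x`, which lies in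
`X`. -/
theorem IsProj.inner_step_le (hX : Convex ℝ X) {x g p : Vec d} {η : ℝ} (hη : 0 < η)
    (hx : x ∈ X) (hp : IsProj X (x - η • g) p) :
    inner ℝ g (p - x) ≤ -(η⁻¹ * ‖p - x‖ ^ 2) := by
  have h := hp.inner_le_zero hX x hx
  have h1 : inner ℝ (x - η • g - p) (x - p) = ‖p - x‖ ^ 2 + η * inner ℝ g (p - x) := by
    rw [← real_inner_self_eq_norm_sq]
    simp only [inner_sub_left, inner_sub_right, inner_smul_left]
    simp
    ring
  rw [h1] at h
  have h2 : inner ℝ g (p - x) = η⁻¹ * (η * inner ℝ g (p - x)) := by field_simp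
  rw [h2, ← mul_neg]
  gcongr
  linarith

end Geometry

/-! ### Descent, stationarity and feasibility in one projected step -/

namespace Problem

variable {d m : ℕ} {Ξ Z : Type*} [MeasurableSpace Ξ] [MeasurableSpace Z]
  {P : Problem d m Ξ Z} {κ : Constants} {β : Measure (Ξ × Z × Z)}

theorem Standing.meanGradQ_eq (hS : P.Standing) (r : ℝ) {x : Vec d} (hx : x ∈ P.X) :
    P.meanGradQ r x = gradient P.f x + P.jacT x (r • P.c x) := by
  rw [meanGradQ, meanGradF, hS.unbiased_gradF x hx, jacT, Finset.smul_sum]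
  congr 1
  refine Finset.sum_congr rfl fun i _ => ?_
  rw [meanGradC, hS.unbiased_gradC x hx i, smul_smul]
  rfl

theorem jacT_smul (P : Problem d m Ξ Z) (r : ℝ) (x : Vec d) (l : Vec m) :
    P.jacT x (r • l) = r • P.jacT x l := by
  simp [jacT, Finset.smul_sum, smul_smul]

theorem Standing.hasFDerivAt_Q (hS : P.Standing) (r : ℝ) {x : Vec d} (hx : x ∈ P.X) :
    HasFDerivAt (P.Q r) (innerSL ℝ (P.meanGradQ r x)) x := by
  have hf : HasFDerivAt P.f (innerSL ℝ (P.meanGradF x)) x := by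
    have := (hS.differentiable_f x hx).hasGradientAt.hasFDerivAt
    rwa [← hS.unbiased_gradF x hx] at this
  have hc : ∀ i, HasFDerivAt (fun y => P.c y i) (innerSL ℝ (P.meanGradC i x)) x := fun i => by
    have := (hS.differentiable_c x hx i).hasGradientAt.hasFDerivAt
    have h := hS.unbiased_gradC x hx i
    unfold nablaC at h
    rwa [← h] at this
  have h := hf.add ((HasFDerivAt.fun_sum (u := Finset.univ)
    fun i _ => (hc i).pow 2).const_mul (r / 2))
  refine h.congr_fderiv ?_
  ext v
  simp [meanGradQ, Finset.mul_sum]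
  refine Finset.sum_congr rfl fun i _ => ?_
  ring

/-- The mean value theorem on the segment, which stays in `X`, and the Lipschitz bound between the
intermediate point and `x`. This loses a factor `2` against the integrated form, which the step size
tolerates. -/
theorem IsSampleLaw.descent (hβ : P.IsSampleLaw β) (hS : P.Standing) (hM : P.MeanSquareSmooth κ)
    (hB : P.Bounds κ) {r : ℝ} (hr : 1 ≤ r) {x y : Vec d} (hx : x ∈ P.X) (hy : y ∈ P.X) :
    P.Q r y ≤ P.Q r x + inner ℝ (P.meanGradQ r x) (y - x) + r * κ.Lt m * ‖y - x‖ ^ 2 := by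
  obtain ⟨z, hz, hzeq⟩ := domain_mvt
    (fun z hz => (hS.hasFDerivAt_Q r hz).hasFDerivWithinAt) hS.convex hx hy
  have hzX : z ∈ P.X := hS.convex.segment_subset hx hy hz
  have hL : 0 ≤ κ.Lt m := Real.sqrt_nonneg _
  have h1 : inner ℝ (P.meanGradQ r z) (y - x) = P.Q r y - P.Q r x := by
    rw [hzeq]; rfl
  have h2 := real_inner_le_norm (P.meanGradQ r z - P.meanGradQ r x) (y - x)
  rw [inner_sub_left] at h2
  have h3 := hβ.norm_meanGradQ_sub_le hS hM hB hr hzX hx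
  have h4 : ‖z - x‖ ≤ ‖y - x‖ := by
    rw [segment_eq_image_lineMap] at hz
    obtain ⟨s, hs, rfl⟩ := hz
    have : AffineMap.lineMap x y s - x = s • (y - x) := by
      simp [AffineMap.lineMap_apply]
    rw [this, norm_smul, Real.norm_of_nonneg hs.1]
    exact mul_le_of_le_one_left (norm_nonneg _) hs.2
  have h5 : ‖P.meanGradQ r z - P.meanGradQ r x‖ * ‖y - x‖ ≤ r * κ.Lt m * ‖y - x‖ * ‖y - x‖ := by
    gcongr
    exact h3.trans (by gcongr)
  nlinarith

/-- Young's inequality with weight `η` spends half of the gain `η⁻¹‖p - x‖²` on the estimator error.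
-/
theorem IsSampleLaw.step_descent (hβ : P.IsSampleLaw β) (hS : P.Standing)
    (hM : P.MeanSquareSmooth κ) (hB : P.Bounds κ) {r η : ℝ} (hr : 1 ≤ r) (hη : 0 < η)
    {x g p : Vec d} (hx : x ∈ P.X) (hp : IsProj P.X (x - η • g) p) :
    P.Q r p ≤ P.Q r x - (η⁻¹ / 2 - r * κ.Lt m) * ‖p - x‖ ^ 2
      + η / 2 * ‖g - P.meanGradQ r x‖ ^ 2 := by
  have h1 := hβ.descent hS hM hB hr hx hp.1
  have h2 := hp.inner_step_le hS.convex hη hx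
  have h3 := real_inner_le_norm (P.meanGradQ r x - g) (p - x)
  rw [inner_sub_left, norm_sub_rev (P.meanGradQ r x) g] at h3
  have h4 : ‖g - P.meanGradQ r x‖ * ‖p - x‖
      ≤ η / 2 * ‖g - P.meanGradQ r x‖ ^ 2 + η⁻¹ / 2 * ‖p - x‖ ^ 2 := by
    have : 0 ≤ η⁻¹ / 2 * (η * ‖g - P.meanGradQ r x‖ - ‖p - x‖) ^ 2 := by positivity
    have h5 : η⁻¹ / 2 * (η * ‖g - P.meanGradQ r x‖ - ‖p - x‖) ^ 2
        = η / 2 * ‖g - P.meanGradQ r x‖ ^ 2 + η⁻¹ / 2 * ‖p - x‖ ^ 2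
          - ‖g - P.meanGradQ r x‖ * ‖p - x‖ := by field_simp; ring
    linarith
  linarith

theorem IsSampleLaw.step_stationarity (hβ : P.IsSampleLaw β) (hS : P.Standing)
    (hM : P.MeanSquareSmooth κ) (hB : P.Bounds κ) {r η : ℝ} (hr : 1 ≤ r) (hη : 0 < η)
    {x g p : Vec d} (hx : x ∈ P.X) (hp : IsProj P.X (x - η • g) p) :
    distNegNormal P.X p (P.meanGradQ r p)
      ≤ (η⁻¹ + r * κ.Lt m) * ‖p - x‖ + ‖g - P.meanGradQ r x‖ := by
  have h1 := hp.distNegNormal_le hS.convex hη (v := P.meanGradQ r p)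
  have h2 := hβ.norm_meanGradQ_sub_le hS hM hB hr hp.1 hx
  have h3 := norm_sub_le_norm_sub_add_norm_sub (P.meanGradQ r p) (P.meanGradQ r x) g
  rw [norm_sub_rev (P.meanGradQ r x) g] at h3
  linarith

/-- Under the regularity condition at `p`, infeasibility is controlled by stationarity. -/
theorem Standing.violation_le (hS : P.Standing) (hB : P.Bounds κ) {r : ℝ}
    (hr : 0 < r) {p : Vec d} (hp : p ∈ P.X)
    (hreg : κ.δ * ‖P.c p‖ ≤ distNegNormal P.X p (P.jacT p (P.c p))) :
    r * κ.δ * ‖P.c p‖ ≤ distNegNormal P.X p (P.meanGradQ r p) + κ.Cgf := by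
  have h1 := mul_distNegNormal_le P.X p (P.jacT p (P.c p)) hr
  rw [← jacT_smul] at h1
  have h2 := distNegNormal_le_add P.X p (P.jacT p (r • P.c p)) (P.meanGradQ r p)
  have h3 : P.jacT p (r • P.c p) - P.meanGradQ r p = -gradient P.f p := by
    rw [hS.meanGradQ_eq r hp]; abel
  rw [h3, norm_neg] at h2
  have h4 := hB.nablaF p hp
  have h5 := mul_le_mul_of_nonneg_left hreg hr.le
  linarith

end Problem

end StochPenalty

/-! ### Adaptedness of the run and independence of the next sample -/

namespace StochPenalty

namespace Problem

variable {d m : ℕ} {Ξ Z Ω : Type*} [MeasurableSpace Ξ] [MeasurableSpace Z]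
  {P : Problem d m Ξ Z} {κ : Constants}

theorem IsRun.mem_X {B : ℕ → Ω → Ξ × Z × Z} {η r a : ℕ → ℝ} {x₁ : Vec d} {x g : ℕ → Ω → Vec d}
    (h : P.IsRun B η r a x₁ x g) {k : ℕ} (hk : 1 ≤ k) (ω : Ω) : x k ω ∈ P.X := by
  rcases Nat.lt_or_eq_of_le hk with h1 | rfl
  · have := (h.x_succ (k - 1) (by omega) ω).1
    rwa [Nat.sub_add_cancel hk] at this
  · rw [h.x_one]; exact h.mem

/-- `x k` depends on the first `k - 1` samples only, and `g k` on the first `k`. -/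
theorem IsRun.measurable [MeasurableSpace Ω] {B : ℕ → Ω → Ξ × Z × Z} {η r a : ℕ → ℝ} {x₁ : Vec d}
    {x g : ℕ → Ω → Vec d} (h : P.IsRun B η r a x₁ x g) (hS : P.Standing) {n : ℕ}
    (hB : ∀ j, 1 ≤ j → j ≤ n → Measurable (B j)) {k : ℕ} (hk : 1 ≤ k) :
    (k ≤ n + 1 → Measurable (x k)) ∧ (k ≤ n → Measurable (g k)) := by
  have hgQ : ∀ (s : ℝ) {u : Ω → Vec d} {b : Ω → Ξ × Z × Z}, Measurable u → Measurable b →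
      Measurable fun ω => P.gradQ s (u ω) (b ω) := fun s u b hu hb =>
    (hS.measurable_gradQ s).comp (hu.prodMk hb)
  induction k, hk using Nat.le_induction with
  | base =>
    have hx : Measurable (x 1) := by
      rw [show x 1 = fun _ => x₁ from funext h.x_one]; exact measurable_const
    refine ⟨fun _ => hx, fun hn => ?_⟩
    rw [show g 1 = fun ω => P.gradQ (r 1) x₁ (B 1 ω) from funext h.g_one]
    exact hgQ _ measurable_const (hB 1 le_rfl hn)
  | succ k hk ih =>
    have hx : k + 1 ≤ n + 1 → Measurable (x (k + 1)) := fun hn =>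
      measurable_of_isProj hS.closed hS.convex ⟨x₁, h.mem⟩
        ((ih.1 (by omega)).sub ((ih.2 (by omega)).const_smul (η k))) (h.x_succ k hk)
    refine ⟨hx, fun hn => ?_⟩
    rw [show g (k + 1) = _ from funext (h.g_succ k hk)]
    have hb := hB (k + 1) (by omega) hn
    exact (hgQ _ (hx (by omega)) hb).add
      (((ih.2 (by omega)).sub (hgQ _ (ih.1 (by omega)) hb)).fun_const_smul _)

theorem IsRun.measurable_history [MeasurableSpace Ω] {B : ℕ → Ω → Ξ × Z × Z} {η r a : ℕ → ℝ}
    {x₁ : Vec d} {x g : ℕ → Ω → Vec d} (h : P.IsRun B η r a x₁ x g) (hS : P.Standing) {k : ℕ}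
    (hk : 1 ≤ k) (hB : ∀ j, 1 ≤ j → j ≤ k → Measurable (B j)) :
    Measurable fun ω => (x k ω, x (k + 1) ω, g k ω) :=
  ((h.measurable hS hB hk).1 (by omega)).prodMk
    (((h.measurable hS hB (show 1 ≤ k + 1 by omega)).1 le_rfl).prodMk
      ((h.measurable hS hB hk).2 le_rfl))

theorem IsSampling.isSampleLaw [MeasurableSpace Ω] {μ : Measure Ω} [IsProbabilityMeasure μ]
    {B : ℕ → Ω → Ξ × Z × Z} (h : P.IsSampling μ B) {k : ℕ} (hk : 1 ≤ k) :
    P.IsSampleLaw (μ.map (B k)) where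
  prob := Measure.isProbabilityMeasure_map (h.measurable k hk).aemeasurable
  xi := by
    rw [Measure.map_map measurable_fst (h.measurable k hk)]
    exact h.law_xi k hk
  zeta₁ := by
    exact (Measure.map_map (measurable_fst.comp measurable_snd) (h.measurable k hk)).trans
      (h.law_zeta₁ k hk)
  zeta₂ := by
    exact (Measure.map_map (measurable_snd.comp measurable_snd) (h.measurable k hk)).trans
      (h.law_zeta₂ k hk)
  pair := by
    rw [Measure.map_map measurable_snd (h.measurable k hk)]
    have hm := measurable_snd.comp (h.measurable k hk)
    have := (indepFun_iff_map_prod_eq_prod_map_map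
      (measurable_fst.comp hm).aemeasurable (measurable_snd.comp hm).aemeasurable).1
      (h.indep_zeta k hk)
    refine this.trans ?_
    congr 1
    · exact h.law_zeta₁ k hk
    · exact h.law_zeta₂ k hk

/-- The history up to time `k` is independent of the next sample. -/
theorem IsSampling.indepFun_of_history [mΩ : MeasurableSpace Ω] {μ : Measure Ω}
    [IsProbabilityMeasure μ]
    {B : ℕ → Ω → Ξ × Z × Z} (h : P.IsSampling μ B) {S : Type*} [MeasurableSpace S] {U : Ω → S}
    (k : ℕ) (hU : ∀ 𝓜 : MeasurableSpace Ω, (∀ j, 1 ≤ j → j ≤ k → Measurable[𝓜] (B j)) →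
      Measurable[𝓜] U) : IndepFun U (B (k + 1)) μ := by
  -- Index shift: `mB j` is generated by sample `j + 1`, so `j < k` is the history up to time `k`
  -- and `mB k` is the next sample.
  let mB : ℕ → MeasurableSpace Ω := fun j => MeasurableSpace.comap (B (j + 1)) inferInstance
  have hle : ∀ j, mB j ≤ mΩ := fun j => (h.measurable (j + 1) (by omega)).comap_le
  have hind : iIndep mB μ := h.indep
  have hI := indep_iSup_of_disjoint hle hind (S := {j | j < k}) (T := {k}) (by simp)
  rw [IndepFun_iff_Indep]
  refine indep_of_indep_of_le_left (indep_of_indep_of_le_right hI ?_) ?_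
  · simp [mB]
  · refine Measurable.comap_le (hU _ fun j hj hjk => ?_)
    refine Measurable.mono (comap_measurable (B j)) ?_ le_rfl
    have := le_iSup₂_of_le (f := fun (j : ℕ) (_ : j ∈ {j | j < k}) => mB j) (j - 1)
      (show j - 1 < k by omega) le_rfl
    refine le_trans (le_of_eq ?_) this
    simp only [mB, Nat.sub_add_cancel hj]

end Problem

/-! ### The schedules in terms of `fifthRoot` -/

theorem penalty_eq (ρ : ℝ) (k : ℕ) : penalty ρ k = ρ * fifthRoot k := rfl

theorem rpow_div_five (k : ℕ) (j : ℕ) : (k : ℝ) ^ ((j : ℝ) / 5) = fifthRoot k ^ j := by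
  unfold fifthRoot
  rw [← Real.rpow_natCast, ← Real.rpow_mul (Nat.cast_nonneg k)]
  congr 1
  ring

theorem stepSize_eq (L ρ : ℝ) (k : ℕ) :
    stepSize L ρ k = (9 * (L * ρ) * fifthRoot (k + 1) ^ 3)⁻¹ := by
  have := rpow_div_five (k + 1) 3
  push_cast at this
  unfold stepSize
  rw [this, one_div, mul_assoc 9]

theorem inv_stepSize (L ρ : ℝ) (k : ℕ) :
    (stepSize L ρ k)⁻¹ = 9 * (L * ρ) * fifthRoot (k + 1) ^ 3 := by
  rw [stepSize_eq, inv_inv]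

theorem momentum_eq (k : ℕ) : momentum k = 8 / 9 * (fifthRoot k ^ 4)⁻¹ := by
  have := rpow_div_five k 4
  push_cast at this
  unfold momentum
  rw [this, ← div_div, div_eq_mul_inv (72 / 81 : ℝ)]
  norm_num

theorem one_le_penalty {ρ : ℝ} (hρ : 1 < ρ) {k : ℕ} (hk : 1 ≤ k) : 1 ≤ penalty ρ k := by
  rw [penalty_eq]
  exact one_le_mul_of_one_le_of_one_le hρ.le (one_le_fifthRoot hk)

theorem stepSize_pos {L ρ : ℝ} (hL : 0 < L) (hρ : 1 < ρ) (k : ℕ) : 0 < stepSize L ρ k := by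
  rw [stepSize_eq]
  have := one_le_fifthRoot (show 1 ≤ k + 1 by omega)
  positivity

theorem momentum_nonneg (k : ℕ) : 0 ≤ momentum k := by
  rw [momentum_eq]
  positivity

theorem momentum_le_one {k : ℕ} (hk : 1 ≤ k) : momentum k ≤ 1 := by
  rw [momentum_eq]
  have : (fifthRoot k ^ 4)⁻¹ ≤ 1 := inv_le_one_of_one_le₀ (one_le_pow₀ (one_le_fifthRoot hk))
  linarith

end StochPenalty

/-! ### Verification of the moment recursion along a run -/

namespace StochPenalty

variable {d m : ℕ} {Ξ Z Ω : Type*} [MeasurableSpace Ξ] [MeasurableSpace Z]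

/-- Error of the gradient estimator. -/
noncomputable def gradError (P : Problem d m Ξ Z) (ρ : ℝ) (x g : ℕ → Ω → Vec d) (k : ℕ) (ω : Ω) :
    Vec d :=
  g k ω - P.meanGradQ (penalty ρ k) (x k ω)

/-- The stationarity residual at `x (k + 1)` for the multiplier `ρ_k c(x (k + 1))`. -/
noncomputable def residual (P : Problem d m Ξ Z) (ρ : ℝ) (x : ℕ → Ω → Vec d) (k : ℕ)
    (ω : Ω) : ℝ :=
  distNegNormal P.X (x (k + 1) ω) (P.meanGradQ (penalty ρ k) (x (k + 1) ω))

theorem residual_nonneg (P : Problem d m Ξ Z) (ρ : ℝ) (x : ℕ → Ω → Vec d) (k : ℕ) (ω : Ω) :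
    0 ≤ residual P ρ x k ω := distNegNormal_nonneg _ _ _

variable [MeasurableSpace Ω]

/-- All the hypotheses on a run of the method. -/
structure RunSetting (P : Problem d m Ξ Z) (κ : Constants) (ρ : ℝ) (μ : Measure Ω)
    (B : ℕ → Ω → Ξ × Z × Z) (x₁ : Vec d) (x g : ℕ → Ω → Vec d) : Prop where
  L_pos : 0 < κ.Lt m
  δ_pos : 0 < κ.δ
  one_lt_ρ : 1 < ρ
  standing : P.Standing
  smooth : P.MeanSquareSmooth κ
  variance : P.VarianceBounds κ
  bounds : P.Bounds κ
  sampling : P.IsSampling μ B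
  run : P.IsRun B (stepSize (κ.Lt m) ρ) (penalty ρ) momentum x₁ x g
  f_le : ∀ k, 1 ≤ k → ∀ᵐ ω ∂μ, |P.f (x k ω)| ≤ κ.Bf
  regular : ∀ k, 1 ≤ k → ∀ᵐ ω ∂μ,
    κ.δ * ‖P.c (x k ω)‖ ≤ distNegNormal P.X (x k ω) (P.jacT (x k ω) (P.c (x k ω)))

namespace RunSetting

variable {P : Problem d m Ξ Z} {κ : Constants} {ρ : ℝ} {μ : Measure Ω}
  {B : ℕ → Ω → Ξ × Z × Z} {x₁ : Vec d} {x g : ℕ → Ω → Vec d}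

theorem measurable_x (h : RunSetting P κ ρ μ B x₁ x g) {k : ℕ} (hk : 1 ≤ k) : Measurable (x k) :=
  (h.run.measurable h.standing (n := k) (fun j hj _ => h.sampling.measurable j hj) hk).1 (by omega)

theorem measurable_g (h : RunSetting P κ ρ μ B x₁ x g) {k : ℕ} (hk : 1 ≤ k) : Measurable (g k) :=
  (h.run.measurable h.standing (n := k) (fun j hj _ => h.sampling.measurable j hj) hk).2 le_rfl

theorem measurable_c (h : RunSetting P κ ρ μ B x₁ x g) {k : ℕ} (hk : 1 ≤ k) :
    Measurable fun ω => P.c (x k ω) :=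
  h.standing.measurable_c.comp (h.measurable_x hk)

/-- Differentiability is known only at points of `X`, so continuity is used on the subtype, where
the iterates live. -/
theorem measurable_f (h : RunSetting P κ ρ μ B x₁ x g) {k : ℕ} (hk : 1 ≤ k) :
    Measurable fun ω => P.f (x k ω) := by
  have hc : Continuous (P.X.domRestrict P.f) := continuousOn_iff_continuous_domRestrict.1
    fun y hy => (h.standing.differentiable_f y hy).continuousAt.continuousWithinAt
  exact hc.measurable.comp
    ((h.measurable_x hk).subtype_mk (h := fun ω => h.run.mem_X hk ω))

theorem norm_c_sq_le (h : RunSetting P κ ρ μ B x₁ x g) {k : ℕ} (hk : 1 ≤ k) (ω : Ω) :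
    ‖P.c (x k ω)‖ ^ 2 ≤ m * κ.Cc ^ 2 := by
  rw [EuclideanSpace.norm_sq_eq]
  calc ∑ i, ‖P.c (x k ω) i‖ ^ 2 ≤ ∑ _i : Fin m, κ.Cc ^ 2 := by
        refine Finset.sum_le_sum fun i _ => ?_
        have := h.bounds.c _ (h.run.mem_X hk ω) i
        rw [Real.norm_eq_abs]
        gcongr
    _ = _ := by simp

theorem Q_eq (P : Problem d m Ξ Z) (r : ℝ) (y : Vec d) :
    P.Q r y = P.f y + r / 2 * ‖P.c y‖ ^ 2 := by
  rw [EuclideanSpace.norm_sq_eq]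
  simp [Problem.Q]

theorem penalty_mul_le (h : RunSetting P κ ρ μ B x₁ x g) (k : ℕ) :
    penalty ρ k * κ.Lt m ≤ κ.Lt m * ρ * fifthRoot (k + 1) ^ 3 := by
  have hL := h.L_pos
  have hρ := h.one_lt_ρ
  have ht := one_le_fifthRoot (show 1 ≤ k + 1 by omega)
  have h1 : fifthRoot k ≤ fifthRoot (k + 1) ^ 3 :=
    (fifthRoot_mono (Nat.le_succ k)).trans (le_self_pow₀ ht (by norm_num))
  rw [penalty_eq]
  calc ρ * fifthRoot k * κ.Lt m = κ.Lt m * ρ * fifthRoot k := by ring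
    _ ≤ _ := by gcongr

theorem measurable_residual (h : RunSetting P κ ρ μ B x₁ x g) (k : ℕ) :
    Measurable (residual P ρ x k) := by
  have hx := h.measurable_x (show 1 ≤ k + 1 by omega)
  have hm : Measurable fun ω => P.meanGradQ (penalty ρ k) (x (k + 1) ω) :=
    (h.standing.measurable_meanGradQ (penalty ρ k)).comp hx
  have hp : Measurable fun ω => (x (k + 1) ω, P.meanGradQ (penalty ρ k) (x (k + 1) ω)) :=
    hx.prodMk hm
  have heq : residual P ρ x k = (fun p : Vec d × Vec d => distNegNormal P.X p.1 p.2) ∘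
      fun ω => (x (k + 1) ω, P.meanGradQ (penalty ρ k) (x (k + 1) ω)) := rfl
  rw [heq]
  exact (measurable_distNegNormal P.X).comp hp

theorem violation_pointwise (h : RunSetting P κ ρ μ B x₁ x g) {k : ℕ} (hk : 1 ≤ k) :
    ∀ᵐ ω ∂μ, ‖P.c (x (k + 1) ω)‖ ^ 2 ≤ 4 / κ.δ ^ 2 * (fifthRoot (k + 1) ^ 2)⁻¹ *
      (‖residual P ρ x k ω‖ ^ 2 + κ.Cgf ^ 2) := by
  filter_upwards [h.regular (k + 1) (by omega)] with ω hω
  have hρ := h.one_lt_ρ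
  have hδ := h.δ_pos
  have hs := one_le_fifthRoot hk
  have ht := one_le_fifthRoot (show 1 ≤ k + 1 by omega)
  have hr := one_le_penalty hρ hk
  have h1 := h.standing.violation_le h.bounds (lt_of_lt_of_le one_pos hr)
    (h.run.mem_X (show 1 ≤ k + 1 by omega) ω) hω
  change _ ≤ residual P ρ x k ω + _ at h1
  have h2 : (penalty ρ k * κ.δ * ‖P.c (x (k + 1) ω)‖) ^ 2
      ≤ 2 * (residual P ρ x k ω ^ 2 + κ.Cgf ^ 2) := by
    have : (penalty ρ k * κ.δ * ‖P.c (x (k + 1) ω)‖) ^ 2 ≤ (residual P ρ x k ω + κ.Cgf) ^ 2 := by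
      gcongr
    nlinarith [sq_nonneg (residual P ρ x k ω - κ.Cgf)]
  -- The penalty has index `k` but the rate is recorded at `k + 1`. This costs a factor `2`, and
  -- squaring the sum costs another, hence the `4`.
  have h3 : fifthRoot (k + 1) ^ 2 ≤ 2 * penalty ρ k ^ 2 := by
    refine (half_fifthRoot_succ_le hk 2 (by norm_num)).trans ?_
    rw [penalty_eq]
    gcongr
    exact le_mul_of_one_le_left (by linarith) hρ.le
  have h4 : fifthRoot (k + 1) ^ 2 * (κ.δ ^ 2 * ‖P.c (x (k + 1) ω)‖ ^ 2)
      ≤ 2 * penalty ρ k ^ 2 * (κ.δ ^ 2 * ‖P.c (x (k + 1) ω)‖ ^ 2) := by gcongr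
  rw [Real.norm_eq_abs, sq_abs, ← div_eq_mul_inv, div_div, div_mul_eq_mul_div,
    le_div_iff₀ (by positivity)]
  nlinarith

variable [IsProbabilityMeasure μ]

theorem memLp_c (h : RunSetting P κ ρ μ B x₁ x g) {k : ℕ} (hk : 1 ≤ k) :
    MemLp (fun ω => P.c (x k ω)) 2 μ := by
  refine MemLp.of_bound (h.measurable_c hk).aestronglyMeasurable √(m * κ.Cc ^ 2)
    (Filter.Eventually.of_forall fun ω => ?_)
  exact Real.le_sqrt_of_sq_le (h.norm_c_sq_le hk ω)

theorem integrable_c_sq (h : RunSetting P κ ρ μ B x₁ x g) {k : ℕ} (hk : 1 ≤ k) :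
    Integrable (fun ω => ‖P.c (x k ω)‖ ^ 2) μ :=
  (memLp_two_iff_integrable_sq_norm (h.memLp_c hk).1).1 (h.memLp_c hk)

theorem integrable_Q (h : RunSetting P κ ρ μ B x₁ x g) {k : ℕ} (hk : 1 ≤ k) (r : ℝ) :
    Integrable (fun ω => P.Q r (x k ω)) μ := by
  simp_rw [Q_eq]
  refine Integrable.add ?_ ((h.integrable_c_sq hk).const_mul _)
  exact Integrable.of_bound (h.measurable_f hk).aestronglyMeasurable κ.Bf (h.f_le k hk)

theorem sampleLaw (h : RunSetting P κ ρ μ B x₁ x g) {k : ℕ} (hk : 1 ≤ k) :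
    P.IsSampleLaw (μ.map (B k)) :=
  h.sampling.isSampleLaw hk

theorem norm_meanGradQ_le (h : RunSetting P κ ρ μ B x₁ x g) (r : ℝ) {y : Vec d} (hy : y ∈ P.X) :
    ‖P.meanGradQ r y‖ ≤ κ.Cgf + |r| * |Problem.penBound κ m| := by
  have hβ := h.sampleLaw (le_refl 1)
  have := hβ.prob
  have h1 := (hβ.l2Le_gradPen h.standing h.bounds hy).norm_integral_sq_le
  rw [hβ.integral_gradPen h.standing h.bounds hy] at h1
  have h2 := sq_le_sq.1 h1
  rw [abs_norm] at h2
  refine (norm_add_le _ _).trans (add_le_add ?_ ?_)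
  · rw [Problem.meanGradF, h.standing.unbiased_gradF y hy]
    exact h.bounds.nablaF y hy
  · rw [norm_smul, Real.norm_eq_abs]
    gcongr

/-- The projection is nonexpansive and fixes `x k`, so the step is at most `η_k‖g k‖`; and `g k` is
the error plus a bounded mean gradient. -/
theorem memLp_step (h : RunSetting P κ ρ μ B x₁ x g) {k : ℕ} (hk : 1 ≤ k)
    (he : MemLp (gradError P ρ x g k) 2 μ) : MemLp (fun ω => x (k + 1) ω - x k ω) 2 μ := by
  have hG : MemLp (fun ω => P.meanGradQ (penalty ρ k) (x k ω)) 2 μ :=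
    MemLp.of_bound ((h.standing.measurable_meanGradQ _).comp
      (h.measurable_x hk)).aestronglyMeasurable _
      (Filter.Eventually.of_forall fun ω => h.norm_meanGradQ_le _ (h.run.mem_X hk ω))
  have hg : MemLp (g k) 2 μ := by
    have := he.add hG
    refine this.congr_norm (h.measurable_g hk).aestronglyMeasurable
      (Filter.Eventually.of_forall fun ω => ?_)
    simp [gradError]
  refine hg.of_le_mul (c := stepSize (κ.Lt m) ρ k)
    ((h.measurable_x (by omega)).sub (h.measurable_x hk)).aestronglyMeasurable
    (Filter.Eventually.of_forall fun ω => ?_)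
  have hself : IsProj P.X (x k ω) (x k ω) := ⟨h.run.mem_X hk ω, fun y _ => by simp⟩
  have := (h.run.x_succ k hk ω).norm_sub_le h.standing.convex hself
  rwa [sub_sub_cancel_left, norm_neg, norm_smul,
    Real.norm_of_nonneg (stepSize_pos h.L_pos h.one_lt_ρ k).le] at this

theorem l2Le_gradError_one (h : RunSetting P κ ρ μ B x₁ x g) :
    L2Le μ (gradError P ρ x g 1) (Problem.varConst κ m * ρ ^ 2) := by
  have h1 := (h.sampleLaw (le_refl 1)).l2Le_gradQ_sub_mean h.standing h.variance h.bounds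
    (one_le_penalty h.one_lt_ρ (le_refl 1)) h.run.mem
  have h2 := L2Le.of_map (h.sampling.measurable 1 le_rfl) h1
  have h3 : penalty ρ 1 = ρ := by simp [penalty]
  have h4 : gradError P ρ x g 1
      = fun ω => P.gradQ (penalty ρ 1) x₁ (B 1 ω) - P.meanGradQ (penalty ρ 1) x₁ := by
    funext ω
    rw [gradError, h.run.g_one, h.run.x_one]
  rw [h4]
  refine h2.mono (le_of_eq ?_)
  rw [h3]

/-- The one-sample estimate is applied with the past frozen and then integrated. Taking square
integrability at time `k` as input lets the same statement drive the induction that proves it at all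
times. -/
theorem l2Le_gradError_succ (h : RunSetting P κ ρ μ B x₁ x g) {k : ℕ} (hk : 1 ≤ k)
    (he : MemLp (gradError P ρ x g k) 2 μ) :
    L2Le μ (gradError P ρ x g (k + 1))
      ((1 - momentum (k + 1)) ^ 2 * ∫ ω, ‖gradError P ρ x g k ω‖ ^ 2 ∂μ
        + (2 * momentum (k + 1) ^ 2 * (Problem.varConst κ m * penalty ρ (k + 1) ^ 2)
          + 4 * (penalty ρ k ^ 2 * κ.Lt m ^ 2) * ∫ ω, ‖x (k + 1) ω - x k ω‖ ^ 2 ∂μ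
          + 4 * (penalty ρ (k + 1) - penalty ρ k) ^ 2 * Problem.penBound κ m ^ 2)) := by
  have hstep := h.memLp_step hk he
  have hie := (memLp_two_iff_integrable_sq_norm he.1).1 he
  have his := (memLp_two_iff_integrable_sq_norm hstep.1).1 hstep
  set α := momentum (k + 1)
  set r := penalty ρ k
  set r' := penalty ρ (k + 1)
  let U : Ω → Vec d × Vec d × Vec d := fun ω => (x k ω, x (k + 1) ω, g k ω)
  let ψ : (Vec d × Vec d × Vec d) × (Ξ × Z × Z) → Vec d := fun p =>
    P.gradQ r' p.1.2.1 p.2 + (1 - α) • (p.1.2.2 - P.gradQ r p.1.1 p.2) - P.meanGradQ r' p.1.2.1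
  have hrun := h.run
  have hSt := h.standing
  -- Measurability for every σ-algebra that sees the first `k` samples expresses that the history
  -- depends on nothing else. The point `x (k + 1)` belongs to it, since it is computed from `g k`
  -- before sample `k + 1` is used.
  have hU : ∀ 𝓜 : MeasurableSpace Ω, (∀ j, 1 ≤ j → j ≤ k → Measurable[𝓜] (B j)) →
      Measurable[𝓜] U := fun 𝓜 hB =>
    @Problem.IsRun.measurable_history d m Ξ Z Ω _ _ P 𝓜 B _ _ _ _ _ _ hrun hSt k hk hB
  have hUm : Measurable U := hU _ fun j hj _ => h.sampling.measurable j hj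
  have hψ : Measurable ψ := by
    have e1 : Measurable fun p : (Vec d × Vec d × Vec d) × (Ξ × Z × Z) => p.1.2.1 := by fun_prop
    have e2 : Measurable fun p : (Vec d × Vec d × Vec d) × (Ξ × Z × Z) => p.1.2.2 := by fun_prop
    have e3 : Measurable fun p : (Vec d × Vec d × Vec d) × (Ξ × Z × Z) => p.1.1 := by fun_prop
    exact (((h.standing.measurable_gradQ r').comp (e1.prodMk measurable_snd)).add
      ((e2.sub ((h.standing.measurable_gradQ r).comp
        (e3.prodMk measurable_snd))).fun_const_smul (1 - α))).sub
      ((h.standing.measurable_meanGradQ r').comp e1)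
  have hin := fun ω => (h.sampleLaw (show 1 ≤ k + 1 by omega)).l2Le_estimator h.standing h.smooth
    h.variance h.bounds (one_le_penalty h.one_lt_ρ hk)
    (one_le_penalty h.one_lt_ρ (show 1 ≤ k + 1 by omega)) (momentum_nonneg (k + 1))
    (momentum_le_one (show 1 ≤ k + 1 by omega)) (h.run.mem_X hk ω)
    (h.run.mem_X (show 1 ≤ k + 1 by omega) ω) (g k ω)
  have i1 : Integrable (fun ω => (1 - α) ^ 2 * ‖gradError P ρ x g k ω‖ ^ 2) μ := hie.const_mul _
  have i2 : Integrable (fun ω => 4 * (r ^ 2 * κ.Lt m ^ 2) * ‖x (k + 1) ω - x k ω‖ ^ 2) μ :=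
    his.const_mul _
  have i3 : Integrable (fun ω => 2 * α ^ 2 * (Problem.varConst κ m * r' ^ 2)
      + 4 * (r ^ 2 * κ.Lt m ^ 2) * ‖x (k + 1) ω - x k ω‖ ^ 2) μ := (integrable_const _).add i2
  have i4 : Integrable (fun ω => 2 * α ^ 2 * (Problem.varConst κ m * r' ^ 2)
      + 4 * (r ^ 2 * κ.Lt m ^ 2) * ‖x (k + 1) ω - x k ω‖ ^ 2
      + 4 * (r' - r) ^ 2 * Problem.penBound κ m ^ 2) μ := i3.add (integrable_const _)
  have key := L2Le.of_indep hUm (h.sampling.measurable (k + 1) (by omega))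
    (h.sampling.indepFun_of_history k hU) hψ.stronglyMeasurable (i1.add i4) hin
  have heq : gradError P ρ x g (k + 1) = fun ω => ψ (U ω, B (k + 1) ω) := by
    funext ω
    rw [gradError, h.run.g_succ k hk]
  rw [heq]
  refine key.mono (le_of_eq ?_)
  have e1 := integral_add i1 i4
  have e2 := integral_add i3 (integrable_const (μ := μ)
    (4 * (r' - r) ^ 2 * Problem.penBound κ m ^ 2))
  have e3 := integral_add (integrable_const (μ := μ)
    (2 * α ^ 2 * (Problem.varConst κ m * r' ^ 2))) i2
  refine e1.trans ?_
  rw [e2, e3, integral_const_mul ((1 - α) ^ 2), integral_const_mul (4 * (r ^ 2 * κ.Lt m ^ 2))]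
  simp

theorem memLp_gradError (h : RunSetting P κ ρ μ B x₁ x g) {k : ℕ} (hk : 1 ≤ k) :
    MemLp (gradError P ρ x g k) 2 μ := by
  induction k, hk using Nat.le_induction with
  | base => exact h.l2Le_gradError_one.memLp
  | succ k hk ih => exact (h.l2Le_gradError_succ hk ih).memLp

theorem integrable_gradError_sq (h : RunSetting P κ ρ μ B x₁ x g) {k : ℕ} (hk : 1 ≤ k) :
    Integrable (fun ω => ‖gradError P ρ x g k ω‖ ^ 2) μ :=
  (memLp_two_iff_integrable_sq_norm (h.memLp_gradError hk).1).1 (h.memLp_gradError hk)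

theorem integrable_step_sq (h : RunSetting P κ ρ μ B x₁ x g) {k : ℕ} (hk : 1 ≤ k) :
    Integrable (fun ω => ‖x (k + 1) ω - x k ω‖ ^ 2) μ := by
  have := h.memLp_step hk (h.memLp_gradError hk)
  exact (memLp_two_iff_integrable_sq_norm this.1).1 this

/-- A step at the fixed penalty `ρ_k`, followed by the change to `ρ_{k+1}` at the new point, which
produces the `‖c‖²` term. The coefficient is `9/2` from half the inverse step size minus `1` from
smoothness. -/
theorem descent_pointwise (h : RunSetting P κ ρ μ B x₁ x g) {k : ℕ} (hk : 1 ≤ k) (ω : Ω) :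
    P.Q (penalty ρ (k + 1)) (x (k + 1) ω) ≤ P.Q (penalty ρ k) (x k ω)
      - 7 / 2 * (κ.Lt m * ρ) * fifthRoot (k + 1) ^ 3 * ‖x (k + 1) ω - x k ω‖ ^ 2
      + (fifthRoot (k + 1) ^ 3)⁻¹ / (18 * (κ.Lt m * ρ)) * ‖gradError P ρ x g k ω‖ ^ 2
      + ρ / 2 * (fifthRoot (k + 1) ^ 4)⁻¹ * ‖P.c (x (k + 1) ω)‖ ^ 2 := by
  have hρ := h.one_lt_ρ
  have h1 := (h.sampleLaw (le_refl 1)).step_descent h.standing h.smooth h.bounds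
    (one_le_penalty hρ hk) (stepSize_pos h.L_pos hρ k) (h.run.mem_X hk ω) (h.run.x_succ k hk ω)
  have h2 := h.penalty_mul_le k
  rw [inv_stepSize] at h1
  have h3 : stepSize (κ.Lt m) ρ k / 2 = (fifthRoot (k + 1) ^ 3)⁻¹ / (18 * (κ.Lt m * ρ)) := by
    rw [stepSize_eq, mul_inv, mul_inv, div_eq_mul_inv, div_eq_mul_inv, mul_inv]
    ring
  rw [h3] at h1
  have h4 : P.Q (penalty ρ (k + 1)) (x (k + 1) ω) = P.Q (penalty ρ k) (x (k + 1) ω)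
      + ρ / 2 * (fifthRoot (k + 1) - fifthRoot k) * ‖P.c (x (k + 1) ω)‖ ^ 2 := by
    rw [Q_eq, Q_eq, penalty_eq, penalty_eq]; ring
  have h5 : fifthRoot (k + 1) - fifthRoot k ≤ (fifthRoot (k + 1) ^ 4)⁻¹ := by
    have := fifthRoot_diff_le hk
    have : 0 ≤ (fifthRoot (k + 1) ^ 4)⁻¹ := by positivity
    linarith
  have h6 : ρ / 2 * (fifthRoot (k + 1) - fifthRoot k) * ‖P.c (x (k + 1) ω)‖ ^ 2
      ≤ ρ / 2 * (fifthRoot (k + 1) ^ 4)⁻¹ * ‖P.c (x (k + 1) ω)‖ ^ 2 := by gcongr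
  have h7 := mul_le_mul_of_nonneg_right h2 (sq_nonneg ‖x (k + 1) ω - x k ω‖)
  change _ ≤ _ + _ * ‖gradError P ρ x g k ω‖ ^ 2 at h1
  linarith

theorem residual_le (h : RunSetting P κ ρ μ B x₁ x g) {k : ℕ} (hk : 1 ≤ k) (ω : Ω) :
    residual P ρ x k ω ≤ 10 * (κ.Lt m * ρ) * fifthRoot (k + 1) ^ 3 * ‖x (k + 1) ω - x k ω‖
      + ‖gradError P ρ x g k ω‖ := by
  have hρ := h.one_lt_ρ
  have h1 := (h.sampleLaw (le_refl 1)).step_stationarity h.standing h.smooth h.bounds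
    (one_le_penalty hρ hk) (stepSize_pos h.L_pos hρ k) (h.run.mem_X hk ω) (h.run.x_succ k hk ω)
  rw [inv_stepSize] at h1
  have h2 := mul_le_mul_of_nonneg_right (h.penalty_mul_le k) (norm_nonneg (x (k + 1) ω - x k ω))
  change _ ≤ _ + ‖gradError P ρ x g k ω‖ at h1
  unfold residual
  linarith

theorem l2Le_residual (h : RunSetting P κ ρ μ B x₁ x g) {k : ℕ} (hk : 1 ≤ k) :
    L2Le μ (residual P ρ x k) (200 * (κ.Lt m * ρ) ^ 2 * fifthRoot (k + 1) ^ 6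
      * ∫ ω, ‖x (k + 1) ω - x k ω‖ ^ 2 ∂μ + 2 * ∫ ω, ‖gradError P ρ x g k ω‖ ^ 2 ∂μ) := by
  have he : L2Le μ (fun ω => ‖gradError P ρ x g k ω‖) (∫ ω, ‖gradError P ρ x g k ω‖ ^ 2 ∂μ) :=
    ⟨(h.memLp_gradError hk).norm, by simp⟩
  have hs : L2Le μ (fun ω => ‖x (k + 1) ω - x k ω‖) (∫ ω, ‖x (k + 1) ω - x k ω‖ ^ 2 ∂μ) :=
    ⟨(h.memLp_step hk (h.memLp_gradError hk)).norm, by simp⟩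
  have hsum := (hs.const_smul (10 * (κ.Lt m * ρ) * fifthRoot (k + 1) ^ 3)).add he
  have := L2Le.of_norm_le (M := 1) (h.measurable_residual k).aestronglyMeasurable hsum
    (Filter.Eventually.of_forall fun ω => by
      rw [one_mul, Real.norm_of_nonneg (residual_nonneg P ρ x k ω)]
      exact (h.residual_le hk ω).trans (le_abs_self _))
  refine this.mono (le_of_eq ?_)
  ring

theorem momentRecursion (h : RunSetting P κ ρ μ B x₁ x g) :
    MomentRecursion (κ.Lt m * ρ) ρ κ.δ
      (2 * Problem.varConst κ m * ρ ^ 2 + ρ ^ 2 * Problem.penBound κ m ^ 2) (κ.Cgf ^ 2)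
      (m * κ.Cc ^ 2) (fun k => ∫ ω, P.Q (penalty ρ k) (x k ω) ∂μ)
      (fun k => ∫ ω, ‖gradError P ρ x g k ω‖ ^ 2 ∂μ)
      (fun k => ∫ ω, ‖x (k + 1) ω - x k ω‖ ^ 2 ∂μ)
      (fun k => ∫ ω, ‖P.c (x k ω)‖ ^ 2 ∂μ) where
  E_nonneg k _ := integral_nonneg fun _ => by positivity
  S_nonneg k _ := integral_nonneg fun _ => by positivity
  error k hk := by
    have h1 := (h.l2Le_gradError_succ hk (h.memLp_gradError hk)).le
    refine h1.trans ?_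
    have hE : 0 ≤ ∫ ω, ‖gradError P ρ x g k ω‖ ^ 2 ∂μ := integral_nonneg fun _ => by positivity
    have hSt : 0 ≤ ∫ ω, ‖x (k + 1) ω - x k ω‖ ^ 2 ∂μ := integral_nonneg fun _ => by positivity
    have hα0 := momentum_nonneg (k + 1)
    have hα1 := momentum_le_one (show 1 ≤ k + 1 by omega)
    have hd := fifthRoot_diff_le hk
    have hd0 := sub_nonneg.2 (fifthRoot_mono (Nat.le_succ k))
    have hts := fifthRoot_mono (Nat.le_succ k)
    have ht := one_le_fifthRoot (show 1 ≤ k + 1 by omega)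
    have hs := fifthRoot_nonneg k
    rw [← momentum_eq]
    have e1 : (1 - momentum (k + 1)) ^ 2 ≤ 1 - momentum (k + 1) := by nlinarith
    have hV : 0 ≤ Problem.varConst κ m := by unfold Problem.varConst; positivity
    -- Squared momentum `t⁻⁸` times variance growth `t²` gives the `t⁻⁶`; it dominates the squared
    -- penalty increment, of order `t⁻⁸`, in `e4`.
    have e2 : 2 * momentum (k + 1) ^ 2 * (Problem.varConst κ m * penalty ρ (k + 1) ^ 2)
        ≤ 2 * Problem.varConst κ m * ρ ^ 2 * (fifthRoot (k + 1) ^ 6)⁻¹ := by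
      rw [momentum_eq, penalty_eq]
      have : 2 * (8 / 9 * (fifthRoot (k + 1) ^ 4)⁻¹) ^ 2
          * (Problem.varConst κ m * (ρ * fifthRoot (k + 1)) ^ 2)
          = 64 / 81 * (2 * Problem.varConst κ m * ρ ^ 2 * (fifthRoot (k + 1) ^ 6)⁻¹) := by
        field_simp; ring
      rw [this]
      have : 0 ≤ 2 * Problem.varConst κ m * ρ ^ 2 * (fifthRoot (k + 1) ^ 6)⁻¹ := by positivity
      linarith
    have e3 : 4 * (penalty ρ k ^ 2 * κ.Lt m ^ 2) ≤ 4 * (κ.Lt m * ρ) ^ 2 * fifthRoot (k + 1) ^ 2 := by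
      rw [penalty_eq]
      have : fifthRoot k ^ 2 ≤ fifthRoot (k + 1) ^ 2 := by gcongr
      have := mul_le_mul_of_nonneg_left this (show 0 ≤ 4 * (κ.Lt m * ρ) ^ 2 by positivity)
      linarith
    have e4 : 4 * (penalty ρ (k + 1) - penalty ρ k) ^ 2 * Problem.penBound κ m ^ 2
        ≤ ρ ^ 2 * Problem.penBound κ m ^ 2 * (fifthRoot (k + 1) ^ 6)⁻¹ := by
      rw [penalty_eq, penalty_eq, ← mul_sub]
      have f1 : (fifthRoot (k + 1) - fifthRoot k) ^ 2 ≤ ((fifthRoot (k + 1) ^ 4)⁻¹ / 3) ^ 2 :=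
        pow_le_pow_left₀ hd0 hd 2
      have f2 : ((fifthRoot (k + 1) ^ 4)⁻¹) ^ 2 ≤ (fifthRoot (k + 1) ^ 6)⁻¹ := by
        rw [← inv_pow, ← inv_pow, ← pow_mul]
        exact pow_le_pow_of_le_one (by positivity) (inv_le_one_of_one_le₀ ht) (by norm_num)
      have f3 : 4 * (fifthRoot (k + 1) - fifthRoot k) ^ 2 ≤ (fifthRoot (k + 1) ^ 6)⁻¹ := by
        have : 0 ≤ ((fifthRoot (k + 1) ^ 4)⁻¹) ^ 2 := by positivity
        linarith
      have := mul_le_mul_of_nonneg_left f3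
        (show 0 ≤ ρ ^ 2 * Problem.penBound κ m ^ 2 by positivity)
      linarith
    have e5 := mul_le_mul_of_nonneg_right e1 hE
    have e6 := mul_le_mul_of_nonneg_right e3 hSt
    linarith
  descent k hk := by
    have i1 := h.integrable_Q hk (penalty ρ k)
    have i2 := (h.integrable_step_sq hk).const_mul
      (7 / 2 * (κ.Lt m * ρ) * fifthRoot (k + 1) ^ 3)
    have i3 := (h.integrable_gradError_sq hk).const_mul
      ((fifthRoot (k + 1) ^ 3)⁻¹ / (18 * (κ.Lt m * ρ)))
    have i4 := (h.integrable_c_sq (show 1 ≤ k + 1 by omega)).const_mul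
      (ρ / 2 * (fifthRoot (k + 1) ^ 4)⁻¹)
    have h1 := integral_mono (h.integrable_Q (show 1 ≤ k + 1 by omega) (penalty ρ (k + 1)))
      (((i1.sub i2).add i3).add i4) (fun ω => h.descent_pointwise hk ω)
    refine h1.trans (le_of_eq ?_)
    refine (integral_add ((i1.sub i2).add i3) i4).trans ?_
    refine (congrArg₂ _ (integral_add (i1.sub i2) i3) rfl).trans ?_
    refine (congrArg₂ _ (congrArg₂ _ (integral_sub i1 i2) rfl) rfl).trans ?_
    simp only [integral_const_mul]
  violation k hk := by
    have hR := h.l2Le_residual hk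
    have i1 := (hR.integrable_sq.add (integrable_const (κ.Cgf ^ 2))).const_mul
      (4 / κ.δ ^ 2 * (fifthRoot (k + 1) ^ 2)⁻¹)
    have h1 := integral_mono_ae (h.integrable_c_sq (show 1 ≤ k + 1 by omega)) i1
      (h.violation_pointwise hk)
    refine h1.trans ?_
    rw [integral_const_mul]
    gcongr
    refine (integral_add hR.integrable_sq (integrable_const (κ.Cgf ^ 2))).trans_le ?_
    have := hR.le
    simpa using this
  violation_le k hk := by
    have h1 := integral_mono (h.integrable_c_sq (show 1 ≤ k + 1 by omega))
      (integrable_const (μ := μ) (m * κ.Cc ^ 2))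
      (fun ω => h.norm_c_sq_le (show 1 ≤ k + 1 by omega) ω)
    simpa using h1

end RunSetting

end StochPenalty

/-! ### The uniform random index and the final bound -/

namespace StochPenalty

theorem uniformOn_Icc_eq {K : ℕ} : (uniformOn (Set.Icc 1 K) : Measure ℕ)
    = (K : ENNReal)⁻¹ • Measure.count.restrict (Finset.Icc 1 K : Finset ℕ) := by
  have h : (Set.Icc 1 K : Set ℕ) = (Finset.Icc 1 K : Finset ℕ) := (Finset.coe_Icc 1 K).symm
  rw [uniformOn, ProbabilityTheory.cond, h, Measure.count_apply_finset]
  simp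

/-- Integration against a time index that is uniform on `{1, …, K}` and independent of `ω`. -/
theorem integral_prod_uniformOn {Ω : Type*} [MeasurableSpace Ω] {μ : Measure Ω}
    [IsProbabilityMeasure μ] {K : ℕ} (hK : 1 ≤ K) {φ : Ω × ℕ → ℝ} (hφ : Measurable φ)
    (hint : ∀ k, 1 ≤ k → Integrable (fun ω => φ (ω, k)) μ) :
    Integrable φ (μ.prod (uniformOn (Set.Icc 1 K))) ∧
      ∫ q, φ q ∂(μ.prod (uniformOn (Set.Icc 1 K)))
        = (K : ℝ)⁻¹ * ∑ k ∈ Finset.Icc 1 K, ∫ ω, φ (ω, k) ∂μ := by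
  have hprob : IsProbabilityMeasure (uniformOn (Set.Icc 1 K) : Measure ℕ) :=
    isProbabilityMeasure_uniformOn (Set.finite_Icc 1 K) ⟨1, by simp [hK]⟩
  have hae : ∀ᵐ k ∂(uniformOn (Set.Icc 1 K) : Measure ℕ), Integrable (fun ω => φ (ω, k)) μ := by
    have : ∀ᵐ k ∂(uniformOn (Set.Icc 1 K) : Measure ℕ), k ∈ Set.Icc 1 K :=
      ae_cond_mem measurableSet_Icc
    filter_upwards [this] with k hk using hint k hk.1
  have hfin : ∀ h : ℕ → ℝ, IntegrableOn h (Finset.Icc 1 K : Finset ℕ) Measure.count := fun h => by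
    rw [← (Finset.Icc 1 K : Set ℕ).biUnion_of_singleton]
    exact integrableOn_finset_iUnion.2 fun k _ => integrableOn_singleton (by simp) (by simp)
  have hInt : Integrable φ (μ.prod (uniformOn (Set.Icc 1 K))) := by
    rw [integrable_prod_iff' hφ.aestronglyMeasurable]
    refine ⟨hae, ?_⟩
    rw [uniformOn_Icc_eq]
    exact Integrable.smul_measure (hfin _) (by simp; omega)
  refine ⟨hInt, ?_⟩
  rw [integral_prod_symm _ hInt, uniformOn_Icc_eq, integral_smul_measure,
    setIntegral_finset _ (hfin _)]
  simp

namespace RunSetting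

variable {d m : ℕ} {Ξ Z Ω : Type*} [MeasurableSpace Ξ] [MeasurableSpace Z] [MeasurableSpace Ω]
  {P : Problem d m Ξ Z} {κ : Constants} {ρ : ℝ} {μ : Measure Ω} [IsProbabilityMeasure μ]
  {B : ℕ → Ω → Ξ × Z × Z} {x₁ : Vec d} {x g : ℕ → Ω → Vec d}

theorem Qlow_le (h : RunSetting P κ ρ μ B x₁ x g) {k : ℕ} (hk : 1 ≤ k) :
    κ.Qlow ≤ ∫ ω, P.Q (penalty ρ k) (x k ω) ∂μ := by
  have h1 := integral_mono (integrable_const (μ := μ) κ.Qlow) (h.integrable_Q hk (penalty ρ k))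
    (fun ω => h.bounds.Q _ (lt_of_lt_of_le one_pos (one_le_penalty h.one_lt_ρ hk)) _
      (h.run.mem_X hk ω))
  simpa using h1

theorem initial_le (h : RunSetting P κ ρ μ B x₁ x g) :
    ∫ ω, P.Q (penalty ρ 1) (x 1 ω) ∂μ ≤ κ.Bf + ρ / 2 * (m * κ.Cc ^ 2) := by
  have hρ := h.one_lt_ρ
  have h1 := integral_mono_ae (h.integrable_Q (le_refl 1) (penalty ρ 1))
    (integrable_const (μ := μ) (κ.Bf + ρ / 2 * (m * κ.Cc ^ 2))) (by
      filter_upwards [h.f_le 1 le_rfl] with ω hω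
      rw [Q_eq, show penalty ρ 1 = ρ by simp [penalty]]
      have h2 := h.norm_c_sq_le (le_refl 1) ω
      have h3 := le_of_abs_le hω
      gcongr)
  simpa using h1

/-- The average of the square integrable variables `φ k` is small in mean if the average of their
second moments is at most `ε²`. -/
theorem average_le {φ : ℕ → Ω → ℝ} {s : ℕ → ℝ} {K : ℕ} (hK : 1 ≤ K) {ε : ℝ} (hε : 0 < ε)
    (h0 : ∀ k ω, 0 ≤ φ k ω) (hφ : ∀ k, 1 ≤ k → L2Le μ (φ k) (s k))
    (hs : ∑ k ∈ Finset.Icc 1 K, s k ≤ ε ^ 2 * K) :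
    (K : ℝ)⁻¹ * ∑ k ∈ Finset.Icc 1 K, ∫ ω, φ k ω ∂μ ≤ ε := by
  have hK0 : (0 : ℝ) < K := by exact_mod_cast hK
  have h1 : ∑ k ∈ Finset.Icc 1 K, ∫ ω, φ k ω ∂μ
      ≤ ∑ k ∈ Finset.Icc 1 K, ((s k / ε + ε) / 2) := by
    refine Finset.sum_le_sum fun k hk => ?_
    have := (hφ k (Finset.mem_Icc.1 hk).1).integral_norm_le hε
    simpa only [Real.norm_of_nonneg (h0 k _)] using this
  rw [← Finset.sum_div, Finset.sum_add_distrib, ← Finset.sum_div, Finset.sum_const,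
    Nat.card_Icc, nsmul_eq_mul] at h1
  rw [inv_mul_le_iff₀ hK0]
  refine h1.trans ?_
  have h2 : (∑ k ∈ Finset.Icc 1 K, s k) / ε ≤ ε * K := by
    rw [div_le_iff₀ hε]
    linarith
  rw [show K + 1 - 1 = K by omega]
  linarith

end RunSetting

/-- Constant in the bound for the potential. -/
noncomputable def potentialConst (m : ℕ) (κ : Constants) (ρ : ℝ) : ℝ :=
  max (κ.Bf + ρ / 2 * (m * κ.Cc ^ 2) - κ.Qlow
      + Problem.varConst κ m * ρ ^ 2 / (4 * (κ.Lt m * ρ)))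
    ((2 * Problem.varConst κ m * ρ ^ 2 + ρ ^ 2 * Problem.penBound κ m ^ 2) / (4 * (κ.Lt m * ρ))
      + (2 * ρ / κ.δ ^ 2 * κ.Cgf ^ 2
        + ρ / 2 * (m * κ.Cc ^ 2) * (400 * (κ.Lt m * ρ) * (2 * ρ / κ.δ ^ 2) + 1)))

/-- Constant in the rate of the stationarity residual. -/
noncomputable def residualConst (m : ℕ) (κ : Constants) (ρ : ℝ) : ℝ :=
  148 * (κ.Lt m * ρ) * potentialConst m κ ρ

/-- Constant in the rate of the constraint violation. -/
noncomputable def violationConst (m : ℕ) (κ : Constants) (ρ : ℝ) : ℝ :=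
  4 / κ.δ ^ 2 * (residualConst m κ ρ + 5 * κ.Cgf ^ 2)

theorem potentialConst_nonneg (m : ℕ) (κ : Constants) {ρ : ℝ} (hL : 0 < κ.Lt m) (hρ : 1 < ρ) :
    0 ≤ potentialConst m κ ρ := by
  refine le_max_of_le_right ?_
  have : 0 ≤ Problem.varConst κ m := by unfold Problem.varConst; positivity
  positivity

theorem residualConst_nonneg (m : ℕ) (κ : Constants) {ρ : ℝ} (hL : 0 < κ.Lt m) (hρ : 1 < ρ) :
    0 ≤ residualConst m κ ρ := by
  have := potentialConst_nonneg m κ hL hρ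
  unfold residualConst
  positivity

theorem violationConst_nonneg (m : ℕ) (κ : Constants) {ρ : ℝ} (hL : 0 < κ.Lt m) (hρ : 1 < ρ) :
    0 ≤ violationConst m κ ρ := by
  have := residualConst_nonneg m κ hL hρ
  unfold violationConst
  positivity

namespace RunSetting

variable {d m : ℕ} {Ξ Z Ω : Type*} [MeasurableSpace Ξ] [MeasurableSpace Z] [MeasurableSpace Ω]
  {P : Problem d m Ξ Z} {κ : Constants} {ρ : ℝ} {μ : Measure Ω} [IsProbabilityMeasure μ]
  {B : ℕ → Ω → Ξ × Z × Z} {x₁ : Vec d} {x g : ℕ → Ω → Vec d}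

theorem sum_residual_le (h : RunSetting P κ ρ μ B x₁ x g) (K : ℕ) :
    ∑ k ∈ Finset.Icc 1 K, (200 * (κ.Lt m * ρ) ^ 2 * fifthRoot (k + 1) ^ 6
      * ∫ ω, ‖x (k + 1) ω - x k ω‖ ^ 2 ∂μ + 2 * ∫ ω, ‖gradError P ρ x g k ω‖ ^ 2 ∂μ)
      ≤ residualConst m κ ρ * (fifthRoot (K + 1) ^ 3 * (1 + Real.log ((K + 1 : ℕ) : ℝ))) := by
  have hρ : 0 < ρ := by linarith [h.one_lt_ρ]
  have hL := h.L_pos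
  have ha : 0 < κ.Lt m * ρ := by positivity
  have hV : 0 ≤ Problem.varConst κ m := by unfold Problem.varConst; positivity
  refine h.momentRecursion.sum_le ha hρ (by positivity) (by positivity) (by positivity)
    (Ql := κ.Qlow) (fun k hk => h.Qlow_le hk) ?_ (le_max_right _ _) K
  refine le_trans ?_ (le_max_left _ _)
  have h1 := h.initial_le
  have h2 := h.l2Le_gradError_one.le
  have h3 : (∫ ω, ‖gradError P ρ x g 1 ω‖ ^ 2 ∂μ) / (4 * (κ.Lt m * ρ))
      ≤ Problem.varConst κ m * ρ ^ 2 / (4 * (κ.Lt m * ρ)) := by gcongr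
  linarith

theorem conclusion (h : RunSetting P κ ρ μ B x₁ x g) {ε : ℝ} (hε : 0 < ε) (hε1 : ε ≤ 1) {K : ℕ}
    {A' : ℝ} (hA : 42 * (residualConst m κ ρ + violationConst m κ ρ) + 1 ≤ A')
    (hK : A' ^ 5 * (1 / ε) ^ 5 * (1 + Real.log (1 / ε)) ^ 5 ≤ (K : ℝ)) :
    ∃ lam : Ω × ℕ → Vec m, Measurable lam ∧
      Integrable (fun q : Ω × ℕ => distNegNormal P.X (x (q.2 + 1) q.1)
          (gradient P.f (x (q.2 + 1) q.1) + P.jacT (x (q.2 + 1) q.1) (lam q)))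
        (μ.prod (uniformOn (Set.Icc 1 K))) ∧
      ∫ q : Ω × ℕ, distNegNormal P.X (x (q.2 + 1) q.1)
          (gradient P.f (x (q.2 + 1) q.1) + P.jacT (x (q.2 + 1) q.1) (lam q))
        ∂(μ.prod (uniformOn (Set.Icc 1 K))) ≤ ε ∧
      Integrable (fun q : Ω × ℕ => ‖P.c (x (q.2 + 1) q.1)‖)
        (μ.prod (uniformOn (Set.Icc 1 K))) ∧
      ∫ q : Ω × ℕ, ‖P.c (x (q.2 + 1) q.1)‖ ∂(μ.prod (uniformOn (Set.Icc 1 K))) ≤ ε := by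
  have hR := residualConst_nonneg m κ h.L_pos h.one_lt_ρ
  have hC := violationConst_nonneg m κ h.L_pos h.one_lt_ρ
  have hK1 : 1 ≤ K := by
    have hlog : 0 ≤ Real.log (1 / ε) := Real.log_nonneg (by rw [le_div_iff₀ hε]; linarith)
    have : 0 < A' ^ 5 * (1 / ε) ^ 5 * (1 + Real.log (1 / ε)) ^ 5 := by
      have : 0 < A' := by linarith
      positivity
    have : (0 : ℝ) < K := lt_of_lt_of_le this hK
    exact_mod_cast this
  have hsumR := (h.sum_residual_le K).trans
    (sum_rate_le hR hε hε1 (A' := A') (by linarith) hK1 hK)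
  have hsumC := (h.momentRecursion.sum_violation_le (by positivity) K (h.sum_residual_le K)).trans
    (sum_rate_le hC hε hε1 (A' := A') (by linarith) hK1 hK)
  have hcm : Measurable fun q : Ω × ℕ => P.c (x (q.2 + 1) q.1) :=
    measurable_from_prod_countable_left fun k => h.measurable_c (show 1 ≤ k + 1 by omega)
  have hres : (fun q : Ω × ℕ => distNegNormal P.X (x (q.2 + 1) q.1)
      (gradient P.f (x (q.2 + 1) q.1) + P.jacT (x (q.2 + 1) q.1)
        (penalty ρ q.2 • P.c (x (q.2 + 1) q.1)))) = fun q => residual P ρ x q.2 q.1 := by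
    funext q
    rw [residual, h.standing.meanGradQ_eq _ (h.run.mem_X (show 1 ≤ q.2 + 1 by omega) q.1)]
  have hresm : Measurable fun q : Ω × ℕ => residual P ρ x q.2 q.1 :=
    measurable_from_prod_countable_left fun k => h.measurable_residual k
  have hr := integral_prod_uniformOn (μ := μ) hK1 hresm
    fun k hk => (h.l2Le_residual hk).integrable
  have hc := integral_prod_uniformOn (μ := μ) hK1 hcm.norm
    fun k _ => ((h.memLp_c (show 1 ≤ k + 1 by omega)).integrable one_le_two).norm
  -- The multiplier pairs the penalty of step `k` with the constraint value at `x (k + 1)`, which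
  -- makes the tested vector `∇Q_{ρ_k}(x_{k+1})`.
  refine ⟨fun q => penalty ρ q.2 • P.c (x (q.2 + 1) q.1), ?_, ?_, ?_, hc.1, ?_⟩
  · exact ((measurable_from_nat (f := penalty ρ)).comp measurable_snd).smul hcm
  · rw [hres]; exact hr.1
  · rw [hres, hr.2]
    exact average_le hK1 hε (fun k ω => residual_nonneg P ρ x k ω)
      (fun k hk => h.l2Le_residual hk) hsumR
  · rw [hc.2]
    exact average_le (φ := fun k ω => ‖P.c (x (k + 1) ω)‖) hK1 hε (fun _ _ => norm_nonneg _)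
      (fun k _ => ⟨(h.memLp_c (show 1 ≤ k + 1 by omega)).norm, le_of_eq (by simp)⟩) hsumC

end RunSetting

end StochPenalty

open StochPenalty MeasureTheory ProbabilityTheory in
theorem mainTheorem2 (m : ℕ) (κ : Constants) (hL : 0 < κ.Lt m) (hδ : 0 < κ.δ)
    (ρ : ℝ) (hρ : 1 < ρ) :
    ∃ A : ℝ, 0 < A ∧ ∃ p : ℕ,
      ∀ (d : ℕ) (Ξ Z Ω : Type*) [MeasurableSpace Ξ] [MeasurableSpace Z] [MeasurableSpace Ω]
        (P : Problem d m Ξ Z) (μ : Measure Ω) [IsProbabilityMeasure μ]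
        (B : ℕ → Ω → Ξ × Z × Z) (x₁ : Vec d) (x g : ℕ → Ω → Vec d),
        P.Standing → P.MeanSquareSmooth κ → P.VarianceBounds κ → P.Bounds κ →
        P.IsSampling μ B →
        P.IsRun B (stepSize (κ.Lt m) ρ) (penalty ρ) momentum x₁ x g →
        (∀ k, 1 ≤ k → ∀ᵐ ω ∂μ, |P.f (x k ω)| ≤ κ.Bf) →
        (∀ k, 1 ≤ k → ∀ᵐ ω ∂μ,
          κ.δ * ‖P.c (x k ω)‖ ≤ distNegNormal P.X (x k ω) (P.jacT (x k ω) (P.c (x k ω)))) →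
        ∀ ε : ℝ, 0 < ε → ε ≤ 1 → ∀ K : ℕ,
          A * (1 / ε) ^ 5 * (1 + Real.log (1 / ε)) ^ p ≤ (K : ℝ) →
          ∃ lam : Ω × ℕ → Vec m, Measurable lam ∧
            -- `q = (ω, k̂)` with `k̂` uniform on `{1, …, K}` and independent of the run
            Integrable (fun q : Ω × ℕ => distNegNormal P.X (x (q.2 + 1) q.1)
                (gradient P.f (x (q.2 + 1) q.1) + P.jacT (x (q.2 + 1) q.1) (lam q)))
              (μ.prod (uniformOn (Set.Icc 1 K))) ∧
            ∫ q : Ω × ℕ, distNegNormal P.X (x (q.2 + 1) q.1)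
                (gradient P.f (x (q.2 + 1) q.1) + P.jacT (x (q.2 + 1) q.1) (lam q))
              ∂(μ.prod (uniformOn (Set.Icc 1 K))) ≤ ε ∧
            Integrable (fun q : Ω × ℕ => ‖P.c (x (q.2 + 1) q.1)‖)
              (μ.prod (uniformOn (Set.Icc 1 K))) ∧
            ∫ q : Ω × ℕ, ‖P.c (x (q.2 + 1) q.1)‖
              ∂(μ.prod (uniformOn (Set.Icc 1 K))) ≤ ε := by
  have hR := residualConst_nonneg m κ hL hρ
  have hC := violationConst_nonneg m κ hL hρ
  -- The requirement is linear on `K^{1/5}`, with one power of the logarithm; both exponents `5`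
  -- come from raising it to the fifth power. Using the sum of the two rate constants covers both
  -- conclusions.
  refine ⟨(42 * (residualConst m κ ρ + violationConst m κ ρ) + 1) ^ 5, by positivity, 5, ?_⟩
  intro d Ξ Z Ω _ _ _ P μ _ B x₁ x g hS hM hV hB hSam hRun hf hreg ε hε hε1 K hK
  have h : RunSetting P κ ρ μ B x₁ x g :=
    ⟨hL, hδ, hρ, hS, hM, hV, hB, hSam, hRun, hf, hreg⟩
  exact h.conclusion hε hε1 le_rfl hK
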